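/- Interest rates are zero. For a function $f:(0,\infty)\to\mathbb R$ and $x,v>0$, $\tau\ge 0$ let $$\mathrm{BS}^f(x,v,\tau)=\mathbb E\big[f\big(x\,e^{vW_\tau-\frac12 v^2\tau}\big)\big],\qquad W_\tau\sim N(0,\tau),$$ be the Black--Scholes price of a European option with payoff $f$, stock price $x$, volatility $v$ and time to maturity $\tau$; thus $\mathrm{BS}^f(x,v,0)=f(x)$. We say that $f$ has Black--Scholes prices if this expectation converges absolutely for all $x,v,\tau>0$. Let $T>0$, $1\le p<3$, $1\le q<2$ with $\frac1p+\frac1q>1$. Let $S:[0,T]\to(0,\infty)$ be a continuous path of finite $p$-variation and $\sigma:[0,T]\to(0,\infty)$ a continuous path of finite $q$-variation. Let $f_1:(0,\infty)\to\mathbb R$ be convex and not affine, and let $f_0:(0,\infty)\to\mathbb R$ be smooth; assume that both have Black--Scholes prices. Suppose that the stock is traded at price $S_t$ and that the option with payoff $f_1(S_T)$ and maturity $T$ is traded at every time $t\in[0,T]$ at the price $P_t=\mathrm{BS}^{f_1}(S_t,\sigma_t,T-t)$. The classical gamma-hedging strategy for $f_0$ holds at time $s$ a number $q^1_s$ of options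 and $q^2_s$ of shares such that $$q^1_s\,\partial_S\mathrm{BS}^{f_1}+q^2_s=\partial_S\mathrm{BS}^{f_0},\qquad q^1_s\,\partial_S^2\mathrm{BS}^{f_1}=\partial_S^2\mathrm{BS}^{f_0}\qquad\text{at }(S_s,\sigma_s,T-s).$$ On a finite grid $\pi=\{0=t_0<\dots<t_n=t\}$ a trader starts with wealth $\Pi^\pi_{0}=\mathrm{BS}^{f_0}(S_0,\sigma_0,T)$, holds $(q^1_{t_k},q^2_{t_k})$ on $[t_k,t_{k+1}]$ and keeps the rest of the wealth in the risk-free account, so that $\Pi^\pi_{t_{k+1}}=\Pi^\pi_{t_k}+q^1_{t_k}(P_{t_{k+1}}-P_{t_k})+q^2_{t_k}(S_{t_{k+1}}-S_{t_k})$. 1. For every $t\in[0,T)$: for all $s\in[0,t]$ the functions $\mathrm{BS}^{f_i}(\cdot,\sigma_s,T-s)$, $i=0,1$, are twice continuously differentiable near $S_s$ and the matching equations have a unique solution $(q^1_s,q^2_s)$; and the profit or loss $\Pi^\pi_t-\mathrm{BS}^{f_0}(S_t,\sigma_t,T-t)$ tends to $0$ as the mesh of the grid $\pi$ of $[0,t]$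 tends to $0$. 2. If moreover $f_1$ is smooth and $f_1''(x)>0$ for all $x>0$, then the same holds with $t=T$: the strategy is well defined (in the sense of 1) for all $s\in[0,T]$, and $\Pi^\pi_T-f_0(S_T)\to0$ as the mesh of the grid $\pi$ of $[0,T]$ tends to $0$. -/

import Mathlib

open MeasureTheory ProbabilityTheory Filter Topology Set
open scoped ContDiff

noncomputable section

namespace GammaHedging

/-- A finite grid of time points `a = t₀ < t₁ < ⋯ < tₙ = b`
(only the values `time 0, …, time n` are relevant). -/
structure TimeGrid (a b : ℝ) where
  n : ℕ
  time : ℕ → ℝ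
  time_zero : time 0 = a
  time_last : time n = b
  time_lt : ∀ k < n, time k < time (k + 1)

/-- The mesh of a grid: the length of its longest sub-interval. -/
def TimeGrid.mesh {a b : ℝ} (π : TimeGrid a b) : ℝ :=
  ⨆ k : Fin π.n, (π.time ((k : ℕ) + 1) - π.time (k : ℕ))

/-- Membership in `C^{p-var}([a,b]; ℝ)`: the path is continuous on `[a,b]` and the sums
`∑ |X_{t_{k+1}} - X_{t_k}|^p` over all grids of `[a,b]` are bounded. -/
def IsCPVar (p : ℝ) (X : ℝ → ℝ) (a b : ℝ) : Prop :=
  ContinuousOn X (Icc a b) ∧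
    BddAbove (range fun π : TimeGrid a b =>
      ∑ k ∈ Finset.range π.n, |X (π.time (k + 1)) - X (π.time k)| ^ p)

/-- The value at time `τ` of the driftless geometric Brownian motion with initial value `x` and
volatility `v`, as a function of the value `w` of the driving Brownian motion at time `τ`. -/
def gbm (x v τ w : ℝ) : ℝ :=
  x * Real.exp (v * w - v ^ 2 * τ / 2)

/-- The Black--Scholes price `BS^f(x, v, τ)` (interest rate `0`) of the payoff `f`: the expectation
of `f` under the law at time `τ` of the driftless geometric Brownian motion, the driving Brownian
motion having law `N(0, τ)` at time `τ`. For `τ = 0` this is `f x`. -/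
def bsPrice (f : ℝ → ℝ) (x v τ : ℝ) : ℝ :=
  ∫ w, f (gbm x v τ w) ∂(gaussianReal 0 τ.toNNReal)

/-- The Black--Scholes price of `f` is well defined: the integral that defines `BS^f(x, v, τ)`
converges absolutely for all positive `x`, `v`, `τ`. -/
def HasBSPrice (f : ℝ → ℝ) : Prop :=
  ∀ x v τ : ℝ, 0 < x → 0 < v → 0 < τ →
    Integrable (fun w => f (gbm x v τ w)) (gaussianReal 0 τ.toNNReal)

/-- Black--Scholes delta `∂V/∂S`. -/
def bsDelta (f : ℝ → ℝ) (x v τ : ℝ) : ℝ :=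
  deriv (fun y => bsPrice f y v τ) x

/-- Black--Scholes gamma `∂²V/∂S²`. -/
def bsGamma (f : ℝ → ℝ) (x v τ : ℝ) : ℝ :=
  deriv (fun y => bsDelta f y v τ) x

/-- Classical gamma hedging of the payoff `f₀` by `q.1` units of the option with payoff `f₁` and
`q.2` units of the stock: the first and second derivatives with respect to the stock price match.
(The stock has delta `1` and gamma `0`.) -/
def IsClassicalGammaHedge (f₀ f₁ : ℝ → ℝ) (x v τ : ℝ) (q : ℝ × ℝ) : Prop :=
  q.1 * bsDelta f₁ x v τ + q.2 * 1 = bsDelta f₀ x v τ ∧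
  q.1 * bsGamma f₁ x v τ + q.2 * 0 = bsGamma f₀ x v τ

/-- The wealth at the grid point number `k` of a trader who starts with wealth `w₀`, holds
`(q s).1` units of the option with price process `P` and `(q s).2` units of the stock `S` from each
grid point `s` to the next one, and keeps the remaining wealth in the risk-free account with
interest rate `0`. -/
def wealth {a b : ℝ} (π : TimeGrid a b) (w₀ : ℝ) (P S : ℝ → ℝ) (q : ℝ → ℝ × ℝ) : ℕ → ℝ
  | 0 => w₀
  | k + 1 =>
      (q (π.time k)).1 * P (π.time (k + 1)) + (q (π.time k)).2 * S (π.time (k + 1)) +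
        (wealth π w₀ P S q k - (q (π.time k)).1 * P (π.time k) - (q (π.time k)).2 * S (π.time k))

/-- The discrete-time classical gamma-hedging strategy for the payoff `f₀` with maturity `T`, which
trades in the stock `S` and in the option with payoff `f₁`, maturity `T` and price process `P`,
and which computes its Greeks from the implied volatility `σ`, replicates the amount `X` at time `t`
at the Black--Scholes price:
* at every time the Black--Scholes prices are twice continuously differentiable in the stock price
  and the matching conditions determine the holdings, so that the strategy is well defined;
* starting from the Black--Scholes price of `f₀` at time `0`, the profit or loss at time `t` of the
  strategy on a grid of `[0,t]` tends to zero as the mesh of the grid tends to zero. -/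
def GammaHedgingReplicates (f₀ f₁ P S σ : ℝ → ℝ) (T t X : ℝ) : Prop :=
  (∀ s ∈ Icc 0 t,
    ContDiffAt ℝ 2 (fun y => bsPrice f₀ y (σ s) (T - s)) (S s) ∧
    ContDiffAt ℝ 2 (fun y => bsPrice f₁ y (σ s) (T - s)) (S s) ∧
    ∃! q : ℝ × ℝ, IsClassicalGammaHedge f₀ f₁ (S s) (σ s) (T - s) q) ∧
  ∀ q : ℝ → ℝ × ℝ,
    (∀ s ∈ Icc 0 t, IsClassicalGammaHedge f₀ f₁ (S s) (σ s) (T - s) (q s)) →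
    Tendsto (fun π : TimeGrid 0 t => wealth π (bsPrice f₀ (S 0) (σ 0) T) P S q π.n - X)
      (comap TimeGrid.mesh (𝓝 0)) (𝓝 0)

end GammaHedging

end

/-!
The discrete profit and loss of the gamma hedge is a sum of third-order Taylor remainders, so no
rough integration is needed.

The Black--Scholes price depends on volatility and maturity only through the total variance
`θ = v² τ`, and in the variables `θ` and `y = log x - θ / 2` it solves the heat equation
`∂_θ G = ½ ∂_y² G` with initial value `y ↦ f (exp y)` (`bsPrice_eq_heatFlow`). The stock price
`exp (y + θ / 2)` is itself such a solution. If the first two derivatives in `y` of a combination of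
solutions vanish at a point, then by the heat equation so does its derivative in `θ`, and its
increment is of the order `|δy|³ + |δy| |δθ| + |δθ|²` (`IsHeatTower.exists_taylor_bound`). Matching
delta and gamma means exactly that the position "options plus shares minus liability" is such a
combination at each trading time. The sums of these remainders tend to zero: with the control
`c = |δS|^p + |δσ|^q + δt`, whose sums over grids are bounded, each remainder is at most a constant
times `c^ρ`, where `ρ` is the least of `3/p`, `2/q` and `1/p + 1/q`, hence `ρ > 1`
(`tendsto_sum_remainder`).

Two facts on the heat flow make the constants uniform. First, it has locally bounded derivatives:
for `θ > 0` by domination of the kernel, and up to `θ = 0` for smooth payoffs, although nothing is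
assumed on the growth of their derivatives, by cutting off the payoff outside a neighbourhood of the
range of the path (`abs_heatConv_sub_iteratedDeriv_le`). Secondly, the gamma of a convex payoff that
is not affine is positive before maturity (`heatConv_one_lt_two_of_convexOn`); at maturity it is the
second derivative of the payoff. Hence the holdings are continuous, and so bounded, functions of
time.
-/

noncomputable section

namespace GammaHedging

/-! ### The heat kernel and its space derivatives -/

/-- The `n`-th space derivative of the heat kernel `(2πθ)^{-1/2} exp(-z²/(2θ))`, where `θ` is the
variance, given by the recurrence of the Hermite polynomials. -/
def heatKernel : ℕ → ℝ → ℝ → ℝ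
  | 0, θ, z => (√(2 * Real.pi * θ))⁻¹ * Real.exp (-z ^ 2 / (2 * θ))
  | 1, θ, z => -(z / θ) * ((√(2 * Real.pi * θ))⁻¹ * Real.exp (-z ^ 2 / (2 * θ)))
  | n + 2, θ, z => -(z / θ) * heatKernel (n + 1) θ z - ((n + 1 : ℝ) / θ) * heatKernel n θ z

lemma heatKernel_zero (θ z : ℝ) :
    heatKernel 0 θ z = (√(2 * Real.pi * θ))⁻¹ * Real.exp (-z ^ 2 / (2 * θ)) := by
  simp only [heatKernel]

lemma heatKernel_one (θ z : ℝ) : heatKernel 1 θ z = -(z / θ) * heatKernel 0 θ z := by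
  simp only [heatKernel]

lemma heatKernel_add_two (n : ℕ) (θ z : ℝ) :
    heatKernel (n + 2) θ z
      = -(z / θ) * heatKernel (n + 1) θ z - ((n + 1 : ℝ) / θ) * heatKernel n θ z := by
  rw [heatKernel]

lemma heatKernel_zero_pos {θ : ℝ} (hθ : 0 < θ) (z : ℝ) : 0 < heatKernel 0 θ z := by
  rw [heatKernel_zero]; positivity

lemma hasDerivAt_heatKernel_space {θ : ℝ} (hθ : 0 < θ) (n : ℕ) (z : ℝ) :
    HasDerivAt (heatKernel n θ) (heatKernel (n + 1) θ z) z := by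
  have h0 : ∀ z, HasDerivAt (heatKernel 0 θ) (heatKernel 1 θ z) z := by
    intro z
    have h1 : HasDerivAt (fun z : ℝ => -z ^ 2 / (2 * θ)) (-(z / θ)) z := by
      refine ((hasDerivAt_pow 2 z).neg.div_const (2 * θ)).congr_deriv ?_
      field_simp; norm_num
    have h2 := h1.exp.const_mul (√(2 * Real.pi * θ))⁻¹
    refine (h2.congr_deriv ?_).congr_of_eventuallyEq
      (Eventually.of_forall fun z => heatKernel_zero θ z)
    rw [heatKernel_one, heatKernel_zero]; ring
  have hz : ∀ z, HasDerivAt (fun z : ℝ => -(z / θ)) (-(1 / θ)) z := fun z =>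
    ((hasDerivAt_id z).div_const θ).neg
  induction n using Nat.strong_induction_on generalizing z with
  | _ n ih =>
    match n with
    | 0 => exact h0 z
    | 1 =>
      refine (((hz z).mul (h0 z)).congr_deriv ?_).congr_of_eventuallyEq
        (Eventually.of_forall fun z => heatKernel_one θ z)
      rw [heatKernel_add_two 0]; push_cast; ring
    | n + 2 =>
      have := ((hz z).mul (ih (n + 1) (by lia) z)).sub
        ((ih n (by lia) z).const_mul ((n + 1 : ℝ) / θ))
      refine (this.congr_deriv ?_).congr_of_eventuallyEq
        (Eventually.of_forall fun z => heatKernel_add_two n θ z)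
      rw [heatKernel_add_two (n + 1)]; push_cast; ring

/-- Every space derivative of the heat kernel solves the heat equation `∂_θ = ½ ∂_z²`. -/
lemma hasDerivAt_heatKernel_time {θ : ℝ} (hθ : 0 < θ) (n : ℕ) (z : ℝ) :
    HasDerivAt (fun θ => heatKernel n θ z) (heatKernel (n + 2) θ z / 2) θ := by
  have h0 : HasDerivAt (fun θ => heatKernel 0 θ z) (heatKernel 2 θ z / 2) θ := by
    have h1 : HasDerivAt (fun θ : ℝ => -z ^ 2 / (2 * θ)) (z ^ 2 / (2 * θ ^ 2)) θ := by
      refine (((hasDerivAt_inv hθ.ne').const_mul (-z ^ 2 / 2)).congr_deriv ?_).congr_of_eventuallyEq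
        (Eventually.of_forall fun θ => ?_)
      · field_simp
      · beta_reduce; rw [div_mul_eq_div_div, div_eq_mul_inv (_ / 2)]
    have hs : 0 < √(2 * Real.pi * θ) := by positivity
    have h2 : HasDerivAt (fun θ : ℝ => (√(2 * Real.pi * θ))⁻¹)
        (-(√(2 * Real.pi * θ))⁻¹ / (2 * θ)) θ := by
      have := (((hasDerivAt_id θ).const_mul (2 * Real.pi)).sqrt (by simp; positivity)).inv
        (by simpa using hs.ne')
      refine this.congr_deriv ?_
      have e : √(2 * Real.pi * θ) ^ 2 = 2 * Real.pi * θ := Real.sq_sqrt (by positivity)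
      simp only [id, mul_one]
      rw [e]
      field_simp
    refine ((h2.mul h1.exp).congr_deriv ?_).congr_of_eventuallyEq
      (Eventually.of_forall fun θ => heatKernel_zero θ z)
    rw [heatKernel_add_two 0, heatKernel_one, heatKernel_zero]
    field_simp; push_cast; ring
  have hz : HasDerivAt (fun θ : ℝ => -(z / θ)) (z / θ ^ 2) θ := by
    refine (((hasDerivAt_inv hθ.ne').const_mul (-z)).congr_deriv ?_).congr_of_eventuallyEq
      (Eventually.of_forall fun θ => ?_)
    · field_simp
    · beta_reduce; rw [div_eq_mul_inv]; ring
  have hc : ∀ c : ℝ, HasDerivAt (fun θ : ℝ => c / θ) (-c / θ ^ 2) θ := by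
    intro c
    exact ((hasDerivAt_inv hθ.ne').const_mul c).congr_deriv (by field_simp)
  induction n using Nat.strong_induction_on with
  | _ n ih =>
    match n with
    | 0 => exact h0
    | 1 =>
      refine ((hz.mul h0).congr_deriv ?_).congr_of_eventuallyEq
        (Eventually.of_forall fun θ => heatKernel_one θ z)
      rw [heatKernel_add_two 1, heatKernel_add_two 0, heatKernel_one]; push_cast
      field_simp; ring
    | n + 2 =>
      have := (hz.mul (ih (n + 1) (by lia))).sub ((hc (n + 1 : ℝ)).mul (ih n (by lia)))
      refine (this.congr_deriv ?_).congr_of_eventuallyEq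
        (Eventually.of_forall fun θ => heatKernel_add_two n θ z)
      rw [heatKernel_add_two (n + 2), heatKernel_add_two (n + 1), heatKernel_add_two n]
      push_cast; field_simp; ring

/-- Away from the singularity `(θ, z) = (0, 0)` every derivative of the heat kernel is dominated,
with a factor `θ` to spare, by one fixed Gaussian. -/
lemma abs_heatKernel_le (n : ℕ) {M ε : ℝ} (hε : 0 < ε) :
    ∃ C : ℝ, 0 ≤ C ∧ ∀ θ z : ℝ, 0 < θ → θ ≤ M → ε ≤ z ^ 2 + θ →
      |heatKernel n θ z| ≤ C * θ * Real.exp (-z ^ 2 / (4 * M)) := by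
  -- The ratio `s = z² / θ` controls all monomials: `1 / θ ≤ (1 + s) / ε`, `|z| ≤ (1 + M) (1 + s)`.
  have hinv : ∀ θ z : ℝ, 0 < θ → ε ≤ z ^ 2 + θ → 1 / θ ≤ ε⁻¹ * (1 + z ^ 2 / θ) := by
    intro θ z hθ hz
    rw [inv_mul_eq_div, div_le_div_iff₀ hθ hε]
    have : (1 + z ^ 2 / θ) * θ = θ + z ^ 2 := by field_simp
    linarith
  have habs : ∀ θ z : ℝ, 0 < θ → θ ≤ M → |z| ≤ (1 + M) * (1 + z ^ 2 / θ) := by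
    intro θ z hθ hM
    have h1 : z ^ 2 = θ * (z ^ 2 / θ) := by field_simp
    have h2 : 0 ≤ z ^ 2 / θ := by positivity
    have h3 : |z| ≤ 1 + z ^ 2 := by
      have := sq_abs z
      nlinarith [sq_nonneg (|z| - 1), abs_nonneg z]
    nlinarith [mul_le_mul_of_nonneg_right hM h2]
  have key : ∃ C : ℝ, 0 ≤ C ∧ ∃ N : ℕ, ∀ θ z : ℝ, 0 < θ → θ ≤ M → ε ≤ z ^ 2 + θ →
      |heatKernel n θ z| ≤ C * (1 + z ^ 2 / θ) ^ N * Real.exp (-z ^ 2 / (2 * θ)) := by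
    rcases le_or_gt M 0 with hM0 | hM0
    · exact ⟨0, le_rfl, 0, fun θ z h1 h2 => absurd (h1.trans_le h2) (not_lt.2 hM0)⟩
    induction n using Nat.strong_induction_on with
    | _ n ih =>
      have h0 : ∀ θ z : ℝ, 0 < θ → ε ≤ z ^ 2 + θ →
          |heatKernel 0 θ z| ≤ (1 + ε⁻¹) * (1 + z ^ 2 / θ) ^ 1
            * Real.exp (-z ^ 2 / (2 * θ)) := by
        intro θ z hθ hz
        have h2 : 0 ≤ z ^ 2 / θ := by positivity
        rw [abs_of_pos (heatKernel_zero_pos hθ z), heatKernel_zero]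
        gcongr
        have h3 : (√(2 * Real.pi * θ))⁻¹ ≤ 1 + 1 / θ := by
          have h4 : √θ ≤ √(2 * Real.pi * θ) := by
            apply Real.sqrt_le_sqrt
            nlinarith [Real.pi_gt_three]
          have h5 : (√(2 * Real.pi * θ))⁻¹ ≤ (√θ)⁻¹ := by gcongr
          have h6 : (√θ)⁻¹ ^ 2 = 1 / θ := by
            rw [inv_pow, Real.sq_sqrt hθ.le, one_div]
          nlinarith [sq_nonneg ((√θ)⁻¹ - 1), inv_nonneg.2 (Real.sqrt_nonneg θ)]
        have := hinv θ z hθ hz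
        rw [pow_one]
        nlinarith
      match n with
      | 0 => exact ⟨1 + ε⁻¹, by positivity, 1, fun θ z hθ _ hz => h0 θ z hθ hz⟩
      | 1 =>
        refine ⟨(1 + M) * ε⁻¹ * (1 + ε⁻¹), by positivity, 3, fun θ z hθ hM hz => ?_⟩
        have h2 : 0 ≤ z ^ 2 / θ := by positivity
        rw [heatKernel_one, abs_mul, abs_neg, abs_div, abs_of_pos hθ, div_eq_mul_one_div]
        calc |z| * (1 / θ) * |heatKernel 0 θ z|
            ≤ ((1 + M) * (1 + z ^ 2 / θ)) * (ε⁻¹ * (1 + z ^ 2 / θ)) *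
              ((1 + ε⁻¹) * (1 + z ^ 2 / θ) ^ 1 * Real.exp (-z ^ 2 / (2 * θ))) := by
              gcongr
              exacts [habs θ z hθ hM, hinv θ z hθ hz, h0 θ z hθ hz]
          _ = _ := by ring
      | n + 2 =>
        obtain ⟨C₁, hC₁, N₁, h₁⟩ := ih (n + 1) (by lia)
        obtain ⟨C₂, hC₂, N₂, h₂⟩ := ih n (by lia)
        refine ⟨(1 + M) * ε⁻¹ * C₁ + (n + 1) * ε⁻¹ * C₂, by positivity, 2 + N₁ + N₂,
          fun θ z hθ hM hz => ?_⟩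
        have hs : 0 ≤ z ^ 2 / θ := by positivity
        have hs1 : 1 ≤ 1 + z ^ 2 / θ := by linarith
        rw [heatKernel_add_two]
        refine (abs_sub _ _).trans ?_
        rw [abs_mul, abs_neg, abs_div, abs_of_pos hθ, div_eq_mul_one_div |z|, abs_mul,
          abs_of_nonneg (by positivity : (0 : ℝ) ≤ (n + 1) / θ), div_eq_mul_one_div (n + 1 : ℝ)]
        calc |z| * (1 / θ) * |heatKernel (n + 1) θ z| +
              (n + 1) * (1 / θ) * |heatKernel n θ z|
            ≤ ((1 + M) * (1 + z ^ 2 / θ)) * (ε⁻¹ * (1 + z ^ 2 / θ)) *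
              (C₁ * (1 + z ^ 2 / θ) ^ N₁ * Real.exp (-z ^ 2 / (2 * θ))) +
              (n + 1) * (ε⁻¹ * (1 + z ^ 2 / θ)) *
              (C₂ * (1 + z ^ 2 / θ) ^ N₂ * Real.exp (-z ^ 2 / (2 * θ))) := by
              gcongr
              exacts [habs θ z hθ hM, hinv θ z hθ hz, h₁ θ z hθ hM hz, hinv θ z hθ hz,
                h₂ θ z hθ hM hz]
          _ = ((1 + M) * ε⁻¹ * C₁ * (1 + z ^ 2 / θ) ^ (2 + N₁) +
              (n + 1) * ε⁻¹ * C₂ * (1 + z ^ 2 / θ) ^ (1 + N₂)) *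
                Real.exp (-z ^ 2 / (2 * θ)) := by ring
          _ ≤ ((1 + M) * ε⁻¹ * C₁ * (1 + z ^ 2 / θ) ^ (2 + N₁ + N₂) +
              (n + 1) * ε⁻¹ * C₂ * (1 + z ^ 2 / θ) ^ (2 + N₁ + N₂)) *
                Real.exp (-z ^ 2 / (2 * θ)) := by
              have e1 : (1 + z ^ 2 / θ) ^ (2 + N₁) ≤ (1 + z ^ 2 / θ) ^ (2 + N₁ + N₂) :=
                pow_le_pow_right₀ hs1 (by lia)
              have e2 : (1 + z ^ 2 / θ) ^ (1 + N₂) ≤ (1 + z ^ 2 / θ) ^ (2 + N₁ + N₂) :=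
                pow_le_pow_right₀ hs1 (by lia)
              gcongr
          _ = _ := by ring
  obtain ⟨C, hC, N, h⟩ := key
  refine ⟨C * ε⁻¹ * (4 ^ (N + 1) * (N + 1).factorial * Real.exp (1 / 4)), by positivity,
    fun θ z hθ hM hz => (h θ z hθ hM hz).trans ?_⟩
  set s := z ^ 2 / θ with hs_def
  have hs : 0 ≤ s := by positivity
  have hθs : 1 ≤ θ * (ε⁻¹ * (1 + s)) := by
    have := mul_le_mul_of_nonneg_left (hinv θ z hθ hz) hθ.le
    rwa [mul_one_div_cancel hθ.ne'] at this
  have hpow : (1 + s) ^ (N + 1) ≤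
      4 ^ (N + 1) * (N + 1).factorial * Real.exp (1 / 4) * Real.exp (s / 4) := by
    have := Real.pow_div_factorial_le_exp ((1 + s) / 4) (by positivity) (N + 1)
    rw [div_le_iff₀ (by positivity), div_pow, div_le_iff₀ (by positivity)] at this
    rw [mul_assoc _ (Real.exp _), ← Real.exp_add]
    calc _ ≤ _ := this
      _ = _ := by rw [show 1 / 4 + s / 4 = (1 + s) / 4 by ring]; ring
  have hexp : Real.exp (s / 4) * Real.exp (-z ^ 2 / (2 * θ)) ≤ Real.exp (-z ^ 2 / (4 * M)) := by
    rw [← Real.exp_add, Real.exp_le_exp]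
    have e1 : s / 4 + -z ^ 2 / (2 * θ) = -(z ^ 2 / (4 * θ)) := by rw [hs_def]; field_simp; ring
    rw [e1, neg_div, neg_le_neg_iff]
    gcongr
  calc C * (1 + s) ^ N * Real.exp (-z ^ 2 / (2 * θ))
      ≤ C * (1 + s) ^ N * Real.exp (-z ^ 2 / (2 * θ)) * (θ * (ε⁻¹ * (1 + s))) :=
        le_mul_of_one_le_right (by positivity) hθs
    _ = C * ε⁻¹ * θ * ((1 + s) ^ (N + 1) * Real.exp (-z ^ 2 / (2 * θ))) := by ring
    _ ≤ C * ε⁻¹ * θ * ((4 ^ (N + 1) * (N + 1).factorial * Real.exp (1 / 4) * Real.exp (s / 4)) *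
          Real.exp (-z ^ 2 / (2 * θ))) := by gcongr
    _ = C * ε⁻¹ * (4 ^ (N + 1) * (N + 1).factorial * Real.exp (1 / 4)) * θ *
          (Real.exp (s / 4) * Real.exp (-z ^ 2 / (2 * θ))) := by ring
    _ ≤ _ := by gcongr

/-! ### Convolution with the heat kernel -/

/-- A continuous function that is integrable against every Gaussian. -/
structure GaussianIntegrable (g : ℝ → ℝ) : Prop where
  continuous : Continuous g
  integrable : ∀ y θ : ℝ, 0 < θ → Integrable fun w => g w * Real.exp (-(y - w) ^ 2 / (2 * θ))

/-- The convolution of `g` with the `n`-th derivative of the heat kernel of variance `θ`. -/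
def heatConv (g : ℝ → ℝ) (n : ℕ) (θ y : ℝ) : ℝ :=
  ∫ w, g w * heatKernel n θ (y - w)

lemma continuous_heatKernel {θ : ℝ} (hθ : 0 < θ) (n : ℕ) : Continuous (heatKernel n θ) :=
  continuous_iff_continuousAt.2 fun z => (hasDerivAt_heatKernel_space hθ n z).continuousAt

lemma continuousAt_heatKernel (n : ℕ) {x : ℝ × ℝ} (hx : 0 < x.1) :
    ContinuousAt (fun x : ℝ × ℝ => heatKernel n x.1 x.2) x := by
  have h0 : ContinuousAt (fun x : ℝ × ℝ => heatKernel 0 x.1 x.2) x := by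
    simp only [heatKernel_zero]
    have h1 : √(2 * Real.pi * x.1) ≠ 0 := by positivity
    have h2 : 2 * x.1 ≠ 0 := by positivity
    fun_prop (disch := assumption)
  have hx' := hx.ne'
  induction n using Nat.strong_induction_on with
  | _ n ih =>
    match n with
    | 0 => exact h0
    | 1 =>
      simp only [heatKernel_one]
      fun_prop (disch := assumption)
    | n + 2 =>
      have h1 := ih n (by lia)
      have h2 := ih (n + 1) (by lia)
      simp only [heatKernel_add_two]
      fun_prop (disch := assumption)

/-- Domination of the integrand of `heatConv`, uniformly for `y` in a compact interval and away from
the singularity of the kernel. -/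
lemma GaussianIntegrable.dominated {g : ℝ → ℝ} (hg : GaussianIntegrable g) (n : ℕ) (α β : ℝ)
    {M ε : ℝ} (hM : 0 < M) (hε : 0 < ε) :
    ∃ b : ℝ → ℝ, Integrable b ∧ (∀ w, 0 ≤ b w) ∧ ∀ y ∈ Icc α β, ∀ θ w : ℝ, 0 < θ → θ ≤ M →
      ε ≤ (y - w) ^ 2 + θ → |g w * heatKernel n θ (y - w)| ≤ θ * b w := by
  obtain ⟨C, hC, h⟩ := abs_heatKernel_le n (M := M) hε
  refine ⟨fun w => C * Real.exp ((β - α) ^ 2 / (4 * M)) *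
    |g w * Real.exp (-(α - w) ^ 2 / (2 * (4 * M)))|,
    ((hg.integrable α (4 * M) (by positivity)).abs).const_mul _, fun w => by positivity, ?_⟩
  intro y hy θ w hθ hθM hw
  beta_reduce
  rw [abs_mul, abs_mul, abs_of_pos (Real.exp_pos (-(α - w) ^ 2 / (2 * (4 * M))))]
  have hexp : Real.exp (-(y - w) ^ 2 / (4 * M)) ≤
      Real.exp ((β - α) ^ 2 / (4 * M)) * Real.exp (-(α - w) ^ 2 / (2 * (4 * M))) := by
    rw [← Real.exp_add, Real.exp_le_exp]
    have h1 : (y - α) ^ 2 ≤ (β - α) ^ 2 := by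
      have := hy.1; have := hy.2
      gcongr
    have e : (β - α) ^ 2 / (4 * M) + -(α - w) ^ 2 / (2 * (4 * M)) - -(y - w) ^ 2 / (4 * M) =
      (2 * (β - α) ^ 2 - (α - w) ^ 2 + 2 * (y - w) ^ 2) / (8 * M) := by field_simp; ring
    have : 0 ≤ (2 * (β - α) ^ 2 - (α - w) ^ 2 + 2 * (y - w) ^ 2) / (8 * M) := by
      apply div_nonneg _ (by positivity)
      nlinarith [sq_nonneg (2 * y - w - α)]
    linarith
  calc |g w| * |heatKernel n θ (y - w)|
      ≤ |g w| * (C * θ * (Real.exp ((β - α) ^ 2 / (4 * M)) *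
          Real.exp (-(α - w) ^ 2 / (2 * (4 * M))))) := by
        gcongr
        exact (h θ (y - w) hθ hθM hw).trans (by gcongr)
    _ = _ := by ring

namespace GaussianIntegrable

variable {g : ℝ → ℝ}

lemma continuous_integrand (hg : GaussianIntegrable g) (n : ℕ) {θ : ℝ} (hθ : 0 < θ) (y : ℝ) :
    Continuous fun w => g w * heatKernel n θ (y - w) :=
  hg.continuous.mul ((continuous_heatKernel hθ n).comp (by fun_prop))

lemma integrable_heatKernel (hg : GaussianIntegrable g) (n : ℕ) {θ : ℝ} (hθ : 0 < θ) (y : ℝ) :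
    Integrable fun w => g w * heatKernel n θ (y - w) := by
  obtain ⟨b, hb, _, h⟩ := hg.dominated n y y hθ hθ
  refine (hb.const_mul θ).mono' (hg.continuous_integrand n hθ y).aestronglyMeasurable
    (Eventually.of_forall fun w => ?_)
  exact h y ⟨le_rfl, le_rfl⟩ θ w hθ le_rfl (by nlinarith [sq_nonneg (y - w)])

lemma hasDerivAt_heatConv_space (hg : GaussianIntegrable g) (n : ℕ) {θ : ℝ} (hθ : 0 < θ)
    (y : ℝ) : HasDerivAt (heatConv g n θ) (heatConv g (n + 1) θ y) y := by
  obtain ⟨b, hb, _, h⟩ := hg.dominated (n + 1) (y - 1) (y + 1) hθ hθ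
  refine (hasDerivAt_integral_of_dominated_loc_of_deriv_le (s := Icc (y - 1) (y + 1))
    (F := fun y w => g w * heatKernel n θ (y - w))
    (F' := fun y w => g w * heatKernel (n + 1) θ (y - w)) (bound := fun w => θ * b w)
    (Icc_mem_nhds (by linarith) (by linarith))
    (Eventually.of_forall fun y => (hg.continuous_integrand n hθ y).aestronglyMeasurable)
    (hg.integrable_heatKernel n hθ y) (hg.continuous_integrand (n + 1) hθ y).aestronglyMeasurable
    (Eventually.of_forall fun w x hx => ?_) (hb.const_mul θ)
    (Eventually.of_forall fun w x hx => ?_)).2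
  · exact h x hx θ w hθ le_rfl (by nlinarith [sq_nonneg (x - w)])
  · have := (hasDerivAt_heatKernel_space hθ n (x - w)).comp x ((hasDerivAt_id x).sub_const w)
    simpa using this.const_mul (g w)

lemma hasDerivAt_heatConv_time (hg : GaussianIntegrable g) (n : ℕ) {θ : ℝ} (hθ : 0 < θ)
    (y : ℝ) : HasDerivAt (fun θ => heatConv g n θ y) (heatConv g (n + 2) θ y / 2) θ := by
  obtain ⟨b, hb, hb0, h⟩ := hg.dominated (n + 2) y y (M := 2 * θ) (ε := θ / 2)
    (by positivity) (by positivity)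
  have hpos : ∀ x ∈ Icc (θ / 2) (2 * θ), 0 < x := fun x hx => (half_pos hθ).trans_le hx.1
  have hmem : Icc (θ / 2) (2 * θ) ∈ 𝓝 θ := Icc_mem_nhds (by linarith) (by linarith)
  have key := (hasDerivAt_integral_of_dominated_loc_of_deriv_le (s := Icc (θ / 2) (2 * θ))
    (μ := volume) (F := fun θ w => g w * heatKernel n θ (y - w))
    (F' := fun θ w => g w * heatKernel (n + 2) θ (y - w) / 2)
    (bound := fun w => θ * b w) hmem
    (eventually_of_mem hmem fun x hx =>
      (hg.continuous_integrand n (hpos x hx) y).aestronglyMeasurable)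
    (hg.integrable_heatKernel n hθ y)
    ((hg.continuous_integrand (n + 2) hθ y).div_const 2).aestronglyMeasurable
    (Eventually.of_forall fun w x hx => ?_) (hb.const_mul θ)
    (Eventually.of_forall fun w x hx => ?_)).2
  · simpa only [heatConv, integral_div] using key
  · have h1 := h y ⟨le_rfl, le_rfl⟩ x w (hpos x hx) hx.2 (by nlinarith [sq_nonneg (y - w), hx.1])
    rw [Real.norm_eq_abs, abs_div, abs_two]
    have h2 : x * b w ≤ 2 * θ * b w := mul_le_mul_of_nonneg_right hx.2 (hb0 w)
    linarith
  · refine ((hasDerivAt_heatKernel_time (hpos x hx) n (y - w)).const_mul (g w)).congr_deriv ?_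
    ring

lemma continuousAt_heatConv (hg : GaussianIntegrable g) (n : ℕ) {x : ℝ × ℝ} (hx : 0 < x.2) :
    ContinuousAt (fun x : ℝ × ℝ => heatConv g n x.2 x.1) x := by
  obtain ⟨b, hb, hb0, h⟩ := hg.dominated n (x.1 - 1) (x.1 + 1) (M := 2 * x.2) (ε := x.2 / 2)
    (by positivity) (by positivity)
  have hmem : Icc (x.1 - 1) (x.1 + 1) ×ˢ Icc (x.2 / 2) (2 * x.2) ∈ 𝓝 x :=
    prod_mem_nhds (Icc_mem_nhds (by linarith) (by linarith))
      (Icc_mem_nhds (by linarith) (by linarith))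
  have hpos : ∀ z ∈ Icc (x.1 - 1) (x.1 + 1) ×ˢ Icc (x.2 / 2) (2 * x.2), 0 < z.2 :=
    fun z hz => (half_pos hx).trans_le hz.2.1
  refine continuousAt_of_dominated (bound := fun w => 2 * x.2 * b w)
    (eventually_of_mem hmem fun z hz =>
      (hg.continuous_integrand n (hpos z hz) z.1).aestronglyMeasurable)
    (eventually_of_mem hmem fun z hz => Eventually.of_forall fun w => ?_) (hb.const_mul _)
    (Eventually.of_forall fun w => ?_)
  · refine (h z.1 hz.1 z.2 w (hpos z hz) hz.2.2
      (by nlinarith [sq_nonneg (z.1 - w), hz.2.1])).trans ?_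
    exact mul_le_mul_of_nonneg_right hz.2.2 (hb0 w)
  · have := ContinuousAt.comp (f := fun z : ℝ × ℝ => (z.2, z.1 - w)) (x := x)
      (continuousAt_heatKernel n (x := (x.2, x.1 - w)) hx) (by fun_prop)
    exact continuousAt_const.mul this

end GaussianIntegrable

lemma heatKernel_zero_eq_gaussianPDFReal {θ : ℝ} (hθ : 0 < θ) (y w : ℝ) :
    heatKernel 0 θ (y - w) = gaussianPDFReal y θ.toNNReal w := by
  rw [heatKernel_zero, gaussianPDFReal, Real.coe_toNNReal _ hθ.le, sub_sq_comm]

lemma heatConv_zero_eq_integral (g : ℝ → ℝ) {θ : ℝ} (hθ : 0 < θ) (y : ℝ) :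
    heatConv g 0 θ y = ∫ w, g w ∂(gaussianReal y θ.toNNReal) := by
  rw [integral_gaussianReal_eq_integral_smul (by simpa using hθ)]
  simp only [heatConv, heatKernel_zero_eq_gaussianPDFReal hθ, smul_eq_mul, mul_comm]

/-! ### Smooth initial data -/

lemma integral_abs_sub_gaussianReal_le {θ : ℝ} (hθ : 0 < θ) (y : ℝ) :
    Integrable (fun w => |w - y|) (gaussianReal y θ.toNNReal) ∧
      ∫ w, |w - y| ∂(gaussianReal y θ.toNNReal) ≤ √θ := by
  have h1 : MemLp (fun w : ℝ => w - y) 2 (gaussianReal y θ.toNNReal) :=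
    (memLp_id_gaussianReal 2).sub (memLp_const y)
  have hvar : ∫ w, (w - y) ^ 2 ∂(gaussianReal y θ.toNNReal) = θ := by
    have := variance_fun_id_gaussianReal (μ := y) (v := θ.toNNReal)
    rw [variance_eq_integral (by fun_prop), integral_id_gaussianReal] at this
    rw [this, Real.coe_toNNReal _ hθ.le]
  have hint : Integrable (fun w => |w - y|) (gaussianReal y θ.toNNReal) :=
    (h1.integrable one_le_two).abs
  refine ⟨hint, ?_⟩
  have hs : 0 < √θ := Real.sqrt_pos.2 hθ
  have hs2 : √θ ^ 2 = θ := Real.sq_sqrt hθ.le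
  calc ∫ w, |w - y| ∂(gaussianReal y θ.toNNReal)
      ≤ ∫ w, (√θ / 2 + (w - y) ^ 2 * (2 * √θ)⁻¹) ∂(gaussianReal y θ.toNNReal) := by
        refine integral_mono hint ((integrable_const _).add (h1.integrable_sq.mul_const _))
          fun w => ?_
        have e : √θ / 2 + (w - y) ^ 2 * (2 * √θ)⁻¹ - |w - y| =
            (√θ - |w - y|) ^ 2 * (2 * √θ)⁻¹ := by
          rw [← sq_abs (w - y)]; field_simp; ring
        have : 0 ≤ (√θ - |w - y|) ^ 2 * (2 * √θ)⁻¹ := by positivity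
        beta_reduce
        linarith
    _ = √θ := by
        rw [integral_add (integrable_const _) (h1.integrable_sq.mul_const _), integral_mul_const,
          hvar]
        simp only [integral_const, probReal_univ, smul_eq_mul, one_mul]
        field_simp; rw [hs2]; ring

lemma _root_.HasCompactSupport.gaussianIntegrable {h : ℝ → ℝ} (hc : HasCompactSupport h)
    (hh : Continuous h) : GaussianIntegrable h :=
  ⟨hh, fun _ _ _ => (hh.mul (by fun_prop)).integrable_of_hasCompactSupport hc.mul_right⟩

lemma heatConv_succ_of_hasCompactSupport {h : ℝ → ℝ} (hc : HasCompactSupport h)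
    (hh : ContDiff ℝ ∞ h) (n : ℕ) {θ : ℝ} (hθ : 0 < θ) (y : ℝ) :
    heatConv h (n + 1) θ y = heatConv (deriv h) n θ y := by
  have hcont : Continuous (deriv h) := hh.continuous_deriv (by simp)
  have hv : ∀ w, HasDerivAt (fun w => -heatKernel n θ (y - w))
      (heatKernel (n + 1) θ (y - w)) w := by
    intro w
    have := (hasDerivAt_heatKernel_space hθ n (y - w)).comp w ((hasDerivAt_id w).const_sub y)
    refine this.neg.congr_deriv ?_
    simp
  have key := integral_mul_deriv_eq_deriv_mul_of_integrable (u := h) (u' := deriv h)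
    (fun w _ => (hh.differentiable (by simp) w).hasDerivAt) (fun w _ => hv w)
    ((hc.gaussianIntegrable hh.continuous).integrable_heatKernel (n + 1) hθ y)
    (by simpa only [Pi.mul_def, mul_neg, Pi.neg_def] using
      ((hc.deriv.gaussianIntegrable hcont).integrable_heatKernel n hθ y).neg)
    (by simpa only [Pi.mul_def, mul_neg, Pi.neg_def] using
      ((hc.gaussianIntegrable hh.continuous).integrable_heatKernel n hθ y).neg)
  rw [heatConv, key, heatConv, ← integral_neg]
  simp

lemma contDiff_iteratedDeriv {h : ℝ → ℝ} (hh : ContDiff ℝ ∞ h) (n : ℕ) :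
    ContDiff ℝ ∞ (iteratedDeriv n h) := by
  induction n with
  | zero => simpa using hh
  | succ n ih =>
    rw [iteratedDeriv_succ]
    exact (contDiff_infty_iff_deriv.1 ih).2

lemma _root_.HasCompactSupport.iteratedDeriv {h : ℝ → ℝ} (hc : HasCompactSupport h) (n : ℕ) :
    HasCompactSupport (iteratedDeriv n h) := by
  induction n with
  | zero => simpa using hc
  | succ n ih => rw [iteratedDeriv_succ]; exact ih.deriv

lemma heatConv_eq_iteratedDeriv {h : ℝ → ℝ} (hc : HasCompactSupport h)
    (hh : ContDiff ℝ ∞ h) (n : ℕ) {θ : ℝ} (hθ : 0 < θ) (y : ℝ) :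
    heatConv h n θ y = heatConv (iteratedDeriv n h) 0 θ y := by
  induction n generalizing h with
  | zero => simp
  | succ n ih =>
    rw [heatConv_succ_of_hasCompactSupport hc hh n hθ, iteratedDeriv_succ',
      ih hc.deriv (contDiff_infty_iff_deriv.1 hh).2]

lemma abs_heatConv_sub_le_of_hasCompactSupport {h : ℝ → ℝ} (hc : HasCompactSupport h)
    (hh : ContDiff ℝ ∞ h) (n : ℕ) :
    ∃ C : ℝ, 0 ≤ C ∧ ∀ θ y : ℝ, 0 < θ → |heatConv h n θ y - iteratedDeriv n h y| ≤ C * √θ := by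
  obtain ⟨L, hL⟩ := ContDiff.lipschitzWith_of_hasCompactSupport (hc.iteratedDeriv n)
    (contDiff_iteratedDeriv hh n) (by simp)
  refine ⟨L, L.2, fun θ y hθ => ?_⟩
  rw [heatConv_eq_iteratedDeriv hc hh n hθ, heatConv_zero_eq_integral _ hθ]
  set μ := gaussianReal y θ.toNNReal
  set k := iteratedDeriv n h
  have hk : Integrable k μ := by
    obtain ⟨B, hB⟩ := (hc.iteratedDeriv n).exists_bound_of_continuous
      (contDiff_iteratedDeriv hh n).continuous
    exact Integrable.of_bound (contDiff_iteratedDeriv hh n).continuous.aestronglyMeasurable B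
      (Eventually.of_forall hB)
  have e : ∫ w, k w ∂μ - k y = ∫ w, (k w - k y) ∂μ := by
    rw [integral_sub hk (integrable_const _)]; simp
  rw [e, ← Real.norm_eq_abs]
  obtain ⟨h1, h2⟩ := integral_abs_sub_gaussianReal_le hθ y
  calc ‖∫ w, (k w - k y) ∂μ‖ ≤ ∫ w, L * |w - y| ∂μ :=
        norm_integral_le_of_norm_le (h1.const_mul _) (Eventually.of_forall fun w => by
          simpa [Real.dist_eq] using hL.dist_le_mul w y)
    _ ≤ L * √θ := by
        rw [integral_const_mul]
        exact mul_le_mul_of_nonneg_left h2 L.2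

/-- For smooth initial data every derivative of the heat flow converges to the derivative of the
data as `θ → 0`, locally uniformly. No growth of the derivatives of the data is prescribed: a cutoff
separates the data near the given interval, whose derivatives are bounded, from the rest, which only
sees the tails of the heat kernel. -/
lemma abs_heatConv_sub_iteratedDeriv_le {g : ℝ → ℝ} (hg : GaussianIntegrable g)
    (hs : ContDiff ℝ ∞ g) (n : ℕ) (α β : ℝ) {M : ℝ} (hM : 0 < M) :
    ∃ C : ℝ, 0 ≤ C ∧ ∀ θ y : ℝ, 0 < θ → θ ≤ M → y ∈ Icc α β →
      |heatConv g n θ y - iteratedDeriv n g y| ≤ C * √θ := by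
  rcases le_or_gt α β with hαβ | hαβ
  swap
  · exact ⟨0, le_rfl, fun θ y _ _ hy => absurd (hy.1.trans hy.2) (not_le.2 hαβ)⟩
  let χ : ContDiffBump ((α + β) / 2) := ⟨(β - α) / 2 + 1, (β - α) / 2 + 2, by linarith, by linarith⟩
  have hχ : ∀ w, α - 1 ≤ w → w ≤ β + 1 → χ w = 1 := by
    intro w h1 h2
    apply χ.one_of_mem_closedBall
    rw [Metric.mem_closedBall, Real.dist_eq, abs_le]
    change -((β - α) / 2 + 1) ≤ _ ∧ _ ≤ (β - α) / 2 + 1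
    constructor <;> linarith
  have hχs : ContDiff ℝ ∞ χ := χ.contDiff
  have hc : HasCompactSupport fun w => χ w * g w := χ.hasCompactSupport.mul_right
  have hcs : ContDiff ℝ ∞ fun w => χ w * g w := hχs.mul hs
  have hcg := hc.gaussianIntegrable hcs.continuous
  obtain ⟨C, hC, h⟩ := abs_heatConv_sub_le_of_hasCompactSupport hc hcs n
  obtain ⟨b, hb, hb0, hbd⟩ := hg.dominated n α β hM one_pos
  refine ⟨C + √M * ∫ w, b w, by have : 0 ≤ ∫ w, b w := integral_nonneg hb0; positivity, fun θ y hθ hθM hy => ?_⟩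
  have e1 : iteratedDeriv n g y = iteratedDeriv n (fun w => χ w * g w) y := by
    apply Filter.EventuallyEq.iteratedDeriv_eq
    filter_upwards [Icc_mem_nhds (show α - 1 < y by linarith [hy.1])
      (show y < β + 1 by linarith [hy.2])] with w hw
    rw [hχ w hw.1 hw.2, one_mul]
  have e2 : heatConv g n θ y - heatConv (fun w => χ w * g w) n θ y =
      ∫ w, (1 - χ w) * (g w * heatKernel n θ (y - w)) := by
    rw [heatConv, heatConv, ← integral_sub (hg.integrable_heatKernel n hθ y)
      (hcg.integrable_heatKernel n hθ y)]
    congr 1; ext w; ring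
  have h2 : |heatConv g n θ y - heatConv (fun w => χ w * g w) n θ y| ≤ θ * ∫ w, b w := by
    rw [e2, ← integral_const_mul, ← Real.norm_eq_abs]
    refine norm_integral_le_of_norm_le (hb.const_mul θ) (Eventually.of_forall fun w => ?_)
    by_cases hw : α - 1 ≤ w ∧ w ≤ β + 1
    · rw [hχ w hw.1 hw.2]
      simpa using mul_nonneg hθ.le (hb0 w)
    · have hfar : 1 ≤ (y - w) ^ 2 + θ := by
        have h3 : 1 ≤ (y - w) ^ 2 := by
          rw [one_le_sq_iff_one_le_abs, le_abs]
          rw [not_and_or, not_le, not_le] at hw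
          rcases hw with hw | hw
          · left; linarith [hy.1]
          · right; linarith [hy.2]
        linarith
      rw [norm_mul]
      have h4 : ‖1 - χ w‖ ≤ 1 := by
        rw [Real.norm_eq_abs, abs_le]
        constructor <;> linarith [χ.nonneg (x := w), χ.le_one (x := w)]
      calc ‖1 - χ w‖ * ‖g w * heatKernel n θ (y - w)‖ ≤ 1 * (θ * b w) := by
            gcongr
            exact hbd y hy θ w hθ hθM hfar
        _ = θ * b w := one_mul _
  have h3 : θ ≤ √M * √θ := by
    calc θ = √θ * √θ := (Real.mul_self_sqrt hθ.le).symm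
      _ ≤ √M * √θ := by gcongr
  have h4 := h θ y hθ
  rw [e1]
  calc |heatConv g n θ y - iteratedDeriv n (fun w => χ w * g w) y|
      ≤ |heatConv g n θ y - heatConv (fun w => χ w * g w) n θ y| +
        |heatConv (fun w => χ w * g w) n θ y - iteratedDeriv n (fun w => χ w * g w) y| :=
        abs_sub_le _ _ _
    _ ≤ √M * √θ * (∫ w, b w) + C * √θ := by
        gcongr
        exact h2.trans (mul_le_mul_of_nonneg_right h3 (integral_nonneg hb0))
    _ = _ := by ring

/-! ### Towers of derivatives of solutions of the heat equation -/

/-- `G n θ y` is the `n`-th space derivative of a solution `G 0` of the heat equation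
`∂_θ = ½ ∂_y²`, for the variances `θ` in `J`, up to and including the initial time if `0 ∈ J`. -/
structure IsHeatTower (G : ℕ → ℝ → ℝ → ℝ) (J : Set ℝ) : Prop where
  hasDerivAt_space : ∀ n, ∀ θ ∈ J, ∀ y, HasDerivAt (G n θ) (G (n + 1) θ y) y
  hasDerivAt_time : ∀ n θ, 0 < θ → ∀ y, HasDerivAt (fun θ => G n θ y) (G (n + 2) θ y / 2) θ
  continuousOn : ∀ n, ContinuousOn (fun x : ℝ × ℝ => G n x.2 x.1) (univ ×ˢ J)

/-- The `n`-th space derivative of the solution of the heat equation with initial value `g`,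
including the initial time `θ = 0`. -/
def heatFlow (g : ℝ → ℝ) (n : ℕ) (θ y : ℝ) : ℝ :=
  if 0 < θ then heatConv g n θ y else iteratedDeriv n g y

lemma heatFlow_of_pos (g : ℝ → ℝ) (n : ℕ) {θ : ℝ} (hθ : 0 < θ) (y : ℝ) :
    heatFlow g n θ y = heatConv g n θ y := if_pos hθ

lemma heatFlow_zero_time (g : ℝ → ℝ) (n : ℕ) (y : ℝ) :
    heatFlow g n 0 y = iteratedDeriv n g y := if_neg (lt_irrefl 0)

namespace GaussianIntegrable

variable {g : ℝ → ℝ}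

lemma hasDerivAt_heatFlow_space (hg : GaussianIntegrable g) (n : ℕ) {θ : ℝ} (hθ : 0 < θ) (y : ℝ) :
    HasDerivAt (heatFlow g n θ) (heatFlow g (n + 1) θ y) y := by
  rw [heatFlow_of_pos _ _ hθ, show heatFlow g n θ = heatConv g n θ from
    funext (heatFlow_of_pos g n hθ)]
  exact hg.hasDerivAt_heatConv_space n hθ y

lemma hasDerivAt_heatFlow_time (hg : GaussianIntegrable g) (n : ℕ) {θ : ℝ} (hθ : 0 < θ) (y : ℝ) :
    HasDerivAt (fun θ => heatFlow g n θ y) (heatFlow g (n + 2) θ y / 2) θ := by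
  rw [heatFlow_of_pos _ _ hθ]
  refine (hg.hasDerivAt_heatConv_time n hθ y).congr_of_eventuallyEq ?_
  filter_upwards [lt_mem_nhds hθ] with x hx using heatFlow_of_pos g n hx y

lemma continuousAt_heatFlow (hg : GaussianIntegrable g) (n : ℕ) {x : ℝ × ℝ} (hx : 0 < x.2) :
    ContinuousAt (fun x : ℝ × ℝ => heatFlow g n x.2 x.1) x := by
  refine (hg.continuousAt_heatConv n hx).congr ?_
  filter_upwards [continuous_snd.continuousAt.eventually (lt_mem_nhds hx)] with z hz
  exact (heatFlow_of_pos g n hz z.1).symm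

/-- In general the heat flow is smooth only at positive variance. -/
lemma isHeatTower (hg : GaussianIntegrable g) : IsHeatTower (heatFlow g) (Ioi 0) where
  hasDerivAt_space n _ hθ y := hg.hasDerivAt_heatFlow_space n hθ y
  hasDerivAt_time n _ hθ y := hg.hasDerivAt_heatFlow_time n hθ y
  continuousOn n _ hx := (hg.continuousAt_heatFlow n hx.2).continuousWithinAt

/-- For smooth initial data the heat flow is smooth up to the initial time. -/
lemma isHeatTower_of_contDiff (hg : GaussianIntegrable g) (hs : ContDiff ℝ ∞ g) :
    IsHeatTower (heatFlow g) (Ici 0) where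
  hasDerivAt_space n θ hθ y := by
    rcases (show 0 ≤ θ from hθ).eq_or_lt with rfl | hθ
    · rw [heatFlow_zero_time, iteratedDeriv_succ, show heatFlow g n 0 = iteratedDeriv n g from
        funext (heatFlow_zero_time g n)]
      exact ((contDiff_iteratedDeriv hs n).differentiable (by simp) y).hasDerivAt
    · exact hg.hasDerivAt_heatFlow_space n hθ y
  hasDerivAt_time n _ hθ y := hg.hasDerivAt_heatFlow_time n hθ y
  continuousOn n x hx := by
    rcases (show 0 ≤ x.2 from hx.2).eq_or_lt with hx0 | hx0
    swap
    · exact (hg.continuousAt_heatFlow n hx0).continuousWithinAt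
    obtain ⟨C, hC, h⟩ := abs_heatConv_sub_iteratedDeriv_le hg hs n (x.1 - 1) (x.1 + 1) one_pos
    have hlim : Tendsto (fun z : ℝ × ℝ => heatFlow g n z.2 z.1 - iteratedDeriv n g z.1)
        (𝓝[univ ×ˢ Ici 0] x) (𝓝 0) := by
      have h0 : Tendsto (fun z : ℝ × ℝ => C * √z.2) (𝓝[univ ×ˢ Ici 0] x) (𝓝 0) := by
        have : ContinuousAt (fun z : ℝ × ℝ => C * √z.2) x := by fun_prop
        have := this.tendsto
        simp only [← hx0, Real.sqrt_zero, mul_zero] at this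
        exact this.mono_left nhdsWithin_le_nhds
      refine squeeze_zero_norm' ?_ h0
      have hmem : Icc (x.1 - 1) (x.1 + 1) ×ˢ Iic 1 ∈ 𝓝 x :=
        prod_mem_nhds (Icc_mem_nhds (by linarith) (by linarith)) (Iic_mem_nhds (by linarith))
      filter_upwards [mem_nhdsWithin_of_mem_nhds hmem, self_mem_nhdsWithin] with z hz hz'
      rcases (show 0 ≤ z.2 from hz'.2).eq_or_lt with hz0 | hz0
      · simp [← hz0, heatFlow_zero_time]
      · rw [heatFlow_of_pos _ _ hz0]
        exact h z.2 z.1 hz0 hz.2 hz.1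
    have hcont : Tendsto (fun z : ℝ × ℝ => iteratedDeriv n g z.1) (𝓝[univ ×ˢ Ici 0] x)
        (𝓝 (iteratedDeriv n g x.1)) :=
      ((contDiff_iteratedDeriv hs n).continuous.comp continuous_fst).continuousAt.tendsto.mono_left
        nhdsWithin_le_nhds
    have := hlim.add hcont
    simp only [sub_add_cancel, zero_add] at this
    rw [ContinuousWithinAt, ← hx0, heatFlow_zero_time]
    exact this

end GaussianIntegrable

/-! ### Second-order expansion along the heat equation -/

lemma abs_sub_le_pow_succ_of_abs_deriv_le {r r' : ℝ → ℝ} {y y' K : ℝ} (hK : 0 ≤ K) (k : ℕ)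
    (hr : ∀ z ∈ uIcc y y', HasDerivAt r (r' z) z)
    (hb : ∀ z ∈ uIcc y y', |r' z| ≤ K * |z - y| ^ k) :
    |r y' - r y| ≤ K * |y' - y| ^ (k + 1) := by
  have := (convex_uIcc y y').norm_image_sub_le_of_norm_hasDerivWithin_le
    (C := K * |y' - y| ^ k) (fun z hz => (hr z hz).hasDerivWithinAt)
    (fun z hz => (hb z hz).trans (by
      gcongr K * ?_ ^ k
      exact abs_sub_left_of_mem_uIcc hz)) left_mem_uIcc right_mem_uIcc
  rw [Real.norm_eq_abs, Real.norm_eq_abs] at this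
  rw [pow_succ, ← mul_assoc]
  exact this

/-- The mean value theorem, for end points in either order. -/
lemma exists_sub_eq_mul_sub {φ φ' : ℝ → ℝ} {a b : ℝ} (hc : ContinuousOn φ (uIcc a b))
    (hd : ∀ z, min a b < z → z < max a b → HasDerivAt φ (φ' z) z) :
    ∃ ξ ∈ uIcc a b, φ b - φ a = φ' ξ * (b - a) := by
  rcases lt_trichotomy a b with hab | rfl | hab
  · rw [uIcc_of_le hab.le] at hc ⊢
    rw [min_eq_left hab.le, max_eq_right hab.le] at hd
    obtain ⟨ξ, hξ, h⟩ := exists_hasDerivAt_eq_slope φ φ' hab hc fun z hz => hd z hz.1 hz.2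
    exact ⟨ξ, Ioo_subset_Icc_self hξ, by rw [h, div_mul_cancel₀ _ (sub_pos.2 hab).ne']⟩
  · exact ⟨a, by simp, by simp⟩
  · rw [uIcc_of_ge hab.le] at hc ⊢
    rw [min_eq_right hab.le, max_eq_left hab.le] at hd
    obtain ⟨ξ, hξ, h⟩ := exists_hasDerivAt_eq_slope φ φ' hab hc fun z hz => hd z hz.1 hz.2
    refine ⟨ξ, Ioo_subset_Icc_self hξ, ?_⟩
    rw [h]
    have := (sub_pos.2 hab).ne'
    field_simp; ring

namespace IsHeatTower

variable {G : ℕ → ℝ → ℝ → ℝ} {J : Set ℝ}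

lemma mono {J' : Set ℝ} (hG : IsHeatTower G J) (h : J' ⊆ J) : IsHeatTower G J' where
  hasDerivAt_space n θ hθ := hG.hasDerivAt_space n θ (h hθ)
  hasDerivAt_time := hG.hasDerivAt_time
  continuousOn n := (hG.continuousOn n).mono (prod_mono_right h)

lemma exists_bound (hG : IsHeatTower G J) {α β m M : ℝ} (hJ : Icc m M ⊆ J) (n : ℕ) :
    ∃ B : ℝ, 0 ≤ B ∧ ∀ y ∈ Icc α β, ∀ θ ∈ Icc m M, |G n θ y| ≤ B := by
  obtain ⟨B, hB⟩ := (isCompact_Icc.prod isCompact_Icc).exists_bound_of_continuousOn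
    ((hG.continuousOn n).mono (prod_mono (subset_univ (Icc α β)) hJ))
  exact ⟨max B 0, le_max_right _ _, fun y hy θ hθ =>
    (hB (y, θ) ⟨hy, hθ⟩).trans (le_max_left _ _)⟩

/-- By the heat equation, the first-order term in `θ` carries the second space derivative, like the
second-order term in `y`. -/
lemma exists_taylor_bound (hG : IsHeatTower G J) {α β m M : ℝ} (hm : 0 ≤ m)
    (hJ : Icc m M ⊆ J) :
    ∃ C : ℝ, 0 ≤ C ∧ ∀ y ∈ Icc α β, ∀ y' ∈ Icc α β, ∀ θ ∈ Icc m M, ∀ θ' ∈ Icc m M,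
      |G 0 θ' y' - G 0 θ y - G 1 θ y * (y' - y) - G 2 θ y * ((y' - y) ^ 2 + (θ' - θ)) / 2| ≤
        C * (|y' - y| ^ 3 + |y' - y| * |θ' - θ| + |θ' - θ| ^ 2) := by
  obtain ⟨B₃, hB₃, h₃⟩ := hG.exists_bound (α := α) (β := β) hJ 3
  obtain ⟨B₄, hB₄, h₄⟩ := hG.exists_bound (α := α) (β := β) hJ 4
  refine ⟨B₃ + B₄, by positivity, fun y hy y' hy' θ hθ θ' hθ' => ?_⟩
  -- expansion in space at the variance `θ`
  have hs : ∀ z ∈ uIcc y y', z ∈ Icc α β := fun z hz => uIcc_subset_Icc hy hy' hz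
  have hsub : ∀ z ∈ uIcc y y', uIcc y z ⊆ uIcc y y' := fun z hz =>
    uIcc_subset_uIcc_left hz
  have hd : ∀ n z, HasDerivAt (G n θ) (G (n + 1) θ z) z := fun n =>
    hG.hasDerivAt_space n θ (hJ hθ)
  have s₂ : ∀ z ∈ uIcc y y', |G 2 θ z - G 2 θ y| ≤ B₃ * |z - y| ^ 1 := fun z hz =>
    abs_sub_le_pow_succ_of_abs_deriv_le hB₃ 0 (fun x _ => hd 2 x) fun x hx => by
      simpa using h₃ x (hs x (hsub z hz hx)) θ hθ
  have s₁ : ∀ z ∈ uIcc y y',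
      |G 1 θ z - G 1 θ y - G 2 θ y * (z - y)| ≤ B₃ * |z - y| ^ 2 := fun z hz => by
    have := abs_sub_le_pow_succ_of_abs_deriv_le (r := fun z => G 1 θ z - G 2 θ y * (z - y))
      (r' := fun z => G 2 θ z - G 2 θ y) (y := y) (y' := z) hB₃ 1
      (fun x _ => by
        refine ((hd 1 x).sub
          (((hasDerivAt_id x).sub_const y).const_mul (G 2 θ y))).congr_deriv ?_
        simp)
      fun x hx => s₂ x (hsub z hz hx)
    convert this using 2; ring
  have s₀ : |G 0 θ y' - G 0 θ y - G 1 θ y * (y' - y) - G 2 θ y * (y' - y) ^ 2 / 2| ≤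
      B₃ * |y' - y| ^ 3 := by
    have := abs_sub_le_pow_succ_of_abs_deriv_le
      (r := fun z => G 0 θ z - G 1 θ y * (z - y) - G 2 θ y * (z - y) ^ 2 / 2)
      (r' := fun z => G 1 θ z - G 1 θ y - G 2 θ y * (z - y)) (y := y) (y' := y') hB₃ 2
      (fun x _ => by
        refine (((hd 0 x).sub (((hasDerivAt_id x).sub_const y).const_mul (G 1 θ y))).sub
          (((((hasDerivAt_id x).sub_const y).pow 2).const_mul (G 2 θ y)).div_const 2)).congr_deriv
          ?_
        simp; ring)
      s₁
    convert this using 2; ring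
  -- expansion in the variance at `y'`
  have hθs : ∀ z ∈ uIcc θ θ', z ∈ Icc m M := fun z hz => uIcc_subset_Icc hθ hθ' hz
  have hθpos : ∀ z, min θ θ' < z → 0 < z := fun z hz =>
    (hm.trans (le_min hθ.1 hθ'.1)).trans_lt hz
  have hcont : ∀ n, ContinuousOn (fun θ => G n θ y') (Icc m M) := fun n =>
    (hG.continuousOn n).comp (f := fun θ : ℝ => (y', θ)) (by fun_prop)
      fun θ hθ => ⟨mem_univ _, hJ hθ⟩
  obtain ⟨ξ, hξ, e₀⟩ := exists_sub_eq_mul_sub ((hcont 0).mono hθs)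
    fun z hz _ => hG.hasDerivAt_time 0 z (hθpos z hz) y'
  obtain ⟨η, hη, e₂⟩ := exists_sub_eq_mul_sub (a := θ) (b := ξ)
    ((hcont 2).mono fun z hz => hθs z (uIcc_subset_uIcc_left hξ hz))
    fun z hz _ => hG.hasDerivAt_time 2 z (hθpos z (lt_of_le_of_lt (by
      have := hξ.1
      exact le_min (min_le_left _ _) this) hz)) y'
  have t₂ : |G 2 ξ y' - G 2 θ y'| ≤ B₄ * |θ' - θ| := by
    rw [e₂, abs_mul]
    refine mul_le_mul ?_ (abs_sub_left_of_mem_uIcc hξ) (abs_nonneg _) hB₄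
    · have := h₄ y' hy' η (hθs η (uIcc_subset_uIcc_left hξ hη))
      rw [abs_div, abs_two]
      change |G 4 η y'| / 2 ≤ B₄
      linarith [abs_nonneg (G 4 η y')]
  have t₁ := s₂ y' right_mem_uIcc
  rw [pow_one] at t₁
  have e : G 0 θ' y' - G 0 θ y - G 1 θ y * (y' - y) - G 2 θ y * ((y' - y) ^ 2 + (θ' - θ)) / 2 =
      (G 0 θ y' - G 0 θ y - G 1 θ y * (y' - y) - G 2 θ y * (y' - y) ^ 2 / 2) +
      ((G 2 ξ y' - G 2 θ y') + (G 2 θ y' - G 2 θ y)) * (θ' - θ) / 2 := by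
    have : G 0 θ' y' - G 0 θ y' = G 2 ξ y' / 2 * (θ' - θ) := e₀
    linear_combination this
  rw [e]
  have t₃ : |((G 2 ξ y' - G 2 θ y') + (G 2 θ y' - G 2 θ y)) * (θ' - θ) / 2| ≤
      (B₄ * |θ' - θ| + B₃ * |y' - y|) * |θ' - θ| := by
    rw [abs_div, abs_two, abs_mul]
    have := (abs_add_le (G 2 ξ y' - G 2 θ y') (G 2 θ y' - G 2 θ y)).trans (add_le_add t₂ t₁)
    have := mul_le_mul_of_nonneg_right this (abs_nonneg (θ' - θ))
    have h0 : 0 ≤ |G 2 ξ y' - G 2 θ y' + (G 2 θ y' - G 2 θ y)| * |θ' - θ| := by positivity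
    linarith
  refine (abs_add_le _ _).trans ((add_le_add s₀ t₃).trans ?_)
  have h1 := mul_nonneg hB₄ (pow_nonneg (abs_nonneg (y' - y)) 3)
  have h2 := mul_nonneg hB₄ (mul_nonneg (abs_nonneg (y' - y)) (abs_nonneg (θ' - θ)))
  have h3 := mul_nonneg hB₃ (pow_nonneg (abs_nonneg (θ' - θ)) 2)
  nlinarith

lemma contDiff (hG : IsHeatTower G J) {θ : ℝ} (hθ : θ ∈ J) (k n : ℕ) :
    ContDiff ℝ k (G n θ) := by
  induction k generalizing n with
  | zero =>
    exact contDiff_zero.2 (continuous_iff_continuousAt.2 fun y =>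
      (hG.hasDerivAt_space n θ hθ y).continuousAt)
  | succ k ih =>
    rw [Nat.cast_succ, contDiff_succ_iff_deriv]
    refine ⟨fun y => (hG.hasDerivAt_space n θ hθ y).differentiableAt, by simp, ?_⟩
    rw [show deriv (G n θ) = G (n + 1) θ from
      funext fun y => (hG.hasDerivAt_space n θ hθ y).deriv]
    exact ih (n + 1)

end IsHeatTower

/-! ### Black--Scholes prices as solutions of the heat equation -/

/-- The payoff `f` as a function of the logarithm of the stock price. -/
def logPayoff (f : ℝ → ℝ) (w : ℝ) : ℝ := f (Real.exp w)

lemma continuous_logPayoff {f : ℝ → ℝ} (hf : ContinuousOn f (Ioi 0)) :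
    Continuous (logPayoff f) :=
  hf.comp_continuous Real.continuous_exp Real.exp_pos

lemma gbm_eq_exp {x : ℝ} (hx : 0 < x) (v τ w : ℝ) :
    gbm x v τ w = Real.exp (v * w + (Real.log x - v ^ 2 * τ / 2)) := by
  rw [gbm, show v * w + (Real.log x - v ^ 2 * τ / 2) = Real.log x + (v * w - v ^ 2 * τ / 2) by ring,
    Real.exp_add, Real.exp_log hx]

lemma gaussianReal_map_mul_add (v c : ℝ) {τ : ℝ} (hτ : 0 ≤ τ) :
    (gaussianReal 0 τ.toNNReal).map (fun w => v * w + c) = gaussianReal c (v ^ 2 * τ).toNNReal := by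
  have h : (fun w : ℝ => v * w + c) = (fun w => w + c) ∘ (fun w => v * w) := rfl
  rw [h, ← Measure.map_map (by fun_prop) (by fun_prop), gaussianReal_map_const_mul,
    gaussianReal_map_add_const, mul_zero, zero_add]
  congr 1
  ext
  simp [Real.coe_toNNReal _ hτ, Real.coe_toNNReal _ (mul_nonneg (sq_nonneg v) hτ)]

lemma gaussianIntegrable_of_gaussianReal {g : ℝ → ℝ} (hg : Continuous g)
    (h : ∀ y θ : ℝ, 0 < θ → Integrable g (gaussianReal y θ.toNNReal)) :
    GaussianIntegrable g := by
  refine ⟨hg, fun y θ hθ => ?_⟩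
  have h1 := h y θ hθ
  rw [gaussianReal_of_var_ne_zero _ (by simpa using hθ),
    integrable_withDensity_iff (measurable_gaussianPDF _ _)
      (Eventually.of_forall fun _ => gaussianPDF_lt_top)] at h1
  simp only [toReal_gaussianPDF, ← heatKernel_zero_eq_gaussianPDFReal hθ, heatKernel_zero] at h1
  refine (h1.const_mul (√(2 * Real.pi * θ))).congr (Eventually.of_forall fun w => ?_)
  have : √(2 * Real.pi * θ) ≠ 0 := by positivity
  beta_reduce
  field_simp

lemma HasBSPrice.gaussianIntegrable {f : ℝ → ℝ} (h : HasBSPrice f) (hf : ContinuousOn f (Ioi 0)) :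
    GaussianIntegrable (logPayoff f) := by
  have hc := continuous_logPayoff hf
  refine gaussianIntegrable_of_gaussianReal hc fun y θ hθ => ?_
  have h1 := h (Real.exp (y + θ / 2)) 1 θ (Real.exp_pos _) one_pos hθ
  have e : (fun w => f (gbm (Real.exp (y + θ / 2)) 1 θ w)) =
      logPayoff f ∘ fun w => 1 * w + y := by
    ext w
    rw [gbm_eq_exp (Real.exp_pos _), Real.log_exp, Function.comp, logPayoff]
    congr 2; ring
  rw [e, ← integrable_map_measure hc.aestronglyMeasurable (by fun_prop),
    gaussianReal_map_mul_add _ _ hθ.le] at h1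
  simpa using h1

lemma bsPrice_eq_heatFlow {f : ℝ → ℝ} (hf : ContinuousOn f (Ioi 0)) {x : ℝ} (hx : 0 < x) (v : ℝ)
    {τ : ℝ} (hτ : 0 ≤ τ) :
    bsPrice f x v τ = heatFlow (logPayoff f) 0 (v ^ 2 * τ) (Real.log x - v ^ 2 * τ / 2) := by
  have hc := continuous_logPayoff hf
  have e : bsPrice f x v τ = ∫ w, logPayoff f w
      ∂(gaussianReal (Real.log x - v ^ 2 * τ / 2) (v ^ 2 * τ).toNNReal) := by
    rw [← gaussianReal_map_mul_add _ _ hτ, integral_map (by fun_prop) hc.aestronglyMeasurable,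
      bsPrice]
    simp only [gbm_eq_exp hx, logPayoff]
  rw [e]
  rcases (mul_nonneg (sq_nonneg v) hτ).eq_or_lt with h0 | h0
  · rw [← h0, heatFlow_zero_time]; simp
  · rw [heatFlow_of_pos _ _ h0, heatConv_zero_eq_integral _ h0]

section Greeks

variable {f : ℝ → ℝ} {J : Set ℝ} (hf : ContinuousOn f (Ioi 0))
  (hG : IsHeatTower (heatFlow (logPayoff f)) J) {v τ x : ℝ} (hτ : 0 ≤ τ) (hJ : v ^ 2 * τ ∈ J)
  (hx : 0 < x)
include hf hG hτ hJ hx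

lemma contDiffAt_bsPrice : ContDiffAt ℝ 2 (fun y => bsPrice f y v τ) x := by
  have h : ContDiffAt ℝ 2
      (fun y => heatFlow (logPayoff f) 0 (v ^ 2 * τ) (Real.log y - v ^ 2 * τ / 2)) x :=
    (hG.contDiff hJ 2 0).contDiffAt.comp x
      ((Real.contDiffAt_log.2 hx.ne').sub contDiffAt_const)
  refine h.congr_of_eventuallyEq ?_
  filter_upwards [lt_mem_nhds hx] with y hy using bsPrice_eq_heatFlow hf hy v hτ

lemma bsDelta_eq : bsDelta f x v τ =
    heatFlow (logPayoff f) 1 (v ^ 2 * τ) (Real.log x - v ^ 2 * τ / 2) / x := by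
  have h := (hG.hasDerivAt_space 0 _ hJ (Real.log x - v ^ 2 * τ / 2)).comp x
    ((Real.hasDerivAt_log hx.ne').sub_const (v ^ 2 * τ / 2))
  have e : (fun y => bsPrice f y v τ) =ᶠ[𝓝 x] heatFlow (logPayoff f) 0 (v ^ 2 * τ) ∘
      fun y => Real.log y - v ^ 2 * τ / 2 := by
    filter_upwards [lt_mem_nhds hx] with y hy using bsPrice_eq_heatFlow hf hy v hτ
  exact (h.congr_of_eventuallyEq e).deriv.trans (div_eq_mul_inv _ _).symm

lemma bsGamma_eq : bsGamma f x v τ =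
    (heatFlow (logPayoff f) 2 (v ^ 2 * τ) (Real.log x - v ^ 2 * τ / 2) -
      heatFlow (logPayoff f) 1 (v ^ 2 * τ) (Real.log x - v ^ 2 * τ / 2)) / x ^ 2 := by
  have h := ((hG.hasDerivAt_space 1 _ hJ (Real.log x - v ^ 2 * τ / 2)).comp x
    ((Real.hasDerivAt_log hx.ne').sub_const (v ^ 2 * τ / 2))).div (hasDerivAt_id x) hx.ne'
  have e : (fun y => bsDelta f y v τ) =ᶠ[𝓝 x] (heatFlow (logPayoff f) 1 (v ^ 2 * τ) ∘
      fun y => Real.log y - v ^ 2 * τ / 2) / id := by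
    filter_upwards [lt_mem_nhds hx] with y hy using bsDelta_eq hf hG hτ hJ hy
  rw [bsGamma, (h.congr_of_eventuallyEq e).deriv]
  simp only [Function.comp, id]
  field_simp

end Greeks

/-! ### Positivity of gamma -/

lemma gaussianIntegrable_exp : GaussianIntegrable Real.exp :=
  gaussianIntegrable_of_gaussianReal Real.continuous_exp fun y θ _ => by
    simpa using integrable_exp_mul_gaussianReal (μ := y) (v := θ.toNNReal) 1

lemma gaussianIntegrable_one : GaussianIntegrable fun _ => 1 :=
  gaussianIntegrable_of_gaussianReal continuous_const fun _ _ _ => integrable_const _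

lemma heatConv_exp {θ : ℝ} (hθ : 0 < θ) (n : ℕ) (y : ℝ) :
    heatConv Real.exp n θ y = Real.exp (y + θ / 2) := by
  induction n generalizing y with
  | zero =>
    rw [heatConv_zero_eq_integral _ hθ]
    have := congrFun (mgf_id_gaussianReal (μ := y) (v := θ.toNNReal)) 1
    simpa [mgf, Real.coe_toNNReal _ hθ.le] using this
  | succ n ih =>
    have h1 := gaussianIntegrable_exp.hasDerivAt_heatConv_space n hθ y
    rw [funext ih] at h1
    refine h1.unique ?_
    simpa using ((hasDerivAt_id y).add_const (θ / 2)).exp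

lemma heatConv_one_succ {θ : ℝ} (hθ : 0 < θ) (n : ℕ) (y : ℝ) :
    heatConv (fun _ => 1) (n + 1) θ y = 0 := by
  have h0 : ∀ y, heatConv (fun _ => 1) 0 θ y = 1 := fun y => by
    rw [heatConv_zero_eq_integral _ hθ]; simp
  induction n generalizing y with
  | zero =>
    have h1 := gaussianIntegrable_one.hasDerivAt_heatConv_space 0 hθ y
    rw [funext h0] at h1
    exact h1.unique (hasDerivAt_const y 1)
  | succ n ih =>
    have h1 := gaussianIntegrable_one.hasDerivAt_heatConv_space (n + 1) hθ y
    rw [funext ih] at h1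
    exact h1.unique (hasDerivAt_const y 0)

/-- The Black--Scholes gamma of a convex payoff that is not affine is positive. The kernel
representing gamma annihilates affine payoffs and is a positive multiple of a quadratic polynomial
in the log-price with two real roots. The difference between the payoff and its secant at the two
roots has everywhere the sign of that polynomial. -/
lemma heatConv_one_lt_two_of_convexOn {f : ℝ → ℝ} (hf : ConvexOn ℝ (Ioi 0) f)
    (hne : ¬ ∃ a b : ℝ, ∀ x : ℝ, 0 < x → f x = a * x + b)
    (hg : GaussianIntegrable (logPayoff f)) {θ : ℝ} (hθ : 0 < θ) (y : ℝ) :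
    heatConv (logPayoff f) 1 θ y < heatConv (logPayoff f) 2 θ y := by
  set ρ := √(θ ^ 2 + 4 * θ) with hρ
  have hρ0 : 0 < ρ := by positivity
  have hρ2 : ρ ^ 2 = θ ^ 2 + 4 * θ := Real.sq_sqrt (by positivity)
  set w₁ := y + (θ - ρ) / 2 with hw₁
  set w₂ := y + (θ + ρ) / 2 with hw₂
  have hw : w₁ < w₂ := by rw [hw₁, hw₂]; linarith
  set a := Real.exp w₁
  set b := Real.exp w₂
  have ha : 0 < a := Real.exp_pos _
  have hb : 0 < b := Real.exp_pos _
  have hab : a < b := Real.exp_lt_exp.2 hw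
  have hker : ∀ w, heatKernel 2 θ (y - w) - heatKernel 1 θ (y - w) =
      (w - w₁) * (w - w₂) / θ ^ 2 * heatKernel 0 θ (y - w) := by
    intro w
    have e : (w - w₁) * (w - w₂) = (y - w) ^ 2 + θ * (y - w) - θ := by
      rw [hw₁, hw₂]; linear_combination (-1 / 4) * hρ2
    rw [heatKernel_add_two 0, heatKernel_one, e]
    push_cast; field_simp; ring
  let H : ℝ → ℝ := fun x => (b - a) * f x - (b - x) * f a - (x - a) * f b
  have hsign : ∀ w, 0 ≤ H (Real.exp w) * ((w - w₁) * (w - w₂)) := by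
    intro w
    have hx : 0 < Real.exp w := Real.exp_pos w
    rcases lt_trichotomy w w₁ with h1 | h1 | h1
    · have h2 : Real.exp w < a := Real.exp_lt_exp.2 h1
      have := hf.secant_mono_aux1 (show Real.exp w ∈ Ioi 0 from hx) (show b ∈ Ioi 0 from hb) h2 hab
      have hH : 0 ≤ H (Real.exp w) := by simp only [H]; linarith
      exact mul_nonneg hH (mul_nonneg_of_nonpos_of_nonpos (by linarith) (by linarith))
    · simp [h1]
    rcases lt_trichotomy w w₂ with h2 | h2 | h2
    · have h3 : a < Real.exp w := Real.exp_lt_exp.2 h1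
      have h4 : Real.exp w < b := Real.exp_lt_exp.2 h2
      have := hf.secant_mono_aux1 (show a ∈ Ioi 0 from ha) (show b ∈ Ioi 0 from hb) h3 h4
      have hH : H (Real.exp w) ≤ 0 := by simp only [H]; linarith
      exact mul_nonneg_of_nonpos_of_nonpos hH
        (mul_nonpos_of_nonneg_of_nonpos (by linarith) (by linarith))
    · simp [h2]
    · have h4 : b < Real.exp w := Real.exp_lt_exp.2 h2
      have := hf.secant_mono_aux1 (show a ∈ Ioi 0 from ha) (show Real.exp w ∈ Ioi 0 from hx) hab h4
      have hH : 0 ≤ H (Real.exp w) := by simp only [H]; linarith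
      exact mul_nonneg hH (mul_nonneg (by linarith) (by linarith))
  let D : ℝ → ℝ := fun w => H (Real.exp w) * (heatKernel 2 θ (y - w) - heatKernel 1 θ (y - w))
  have hD : ∀ w, D w = H (Real.exp w) * ((w - w₁) * (w - w₂)) *
      (heatKernel 0 θ (y - w) / θ ^ 2) := by
    intro w; simp only [D, hker]; ring
  have hD0 : ∀ w, 0 ≤ D w := fun w => by
    rw [hD]
    exact mul_nonneg (hsign w) (div_nonneg (heatKernel_zero_pos hθ _).le (by positivity))
  have hcont : Continuous fun w => H (Real.exp w) := by
    have : Continuous fun w => f (Real.exp w) := hg.continuous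
    exact ((continuous_const.mul this).sub (by fun_prop)).sub (by fun_prop)
  have hDc : Continuous D := hcont.mul
    (((continuous_heatKernel hθ 2).comp (by fun_prop)).sub
      ((continuous_heatKernel hθ 1).comp (by fun_prop)))
  have i := fun n => hg.integrable_heatKernel n hθ y
  have j := fun n => gaussianIntegrable_exp.integrable_heatKernel n hθ y
  have k := fun n => gaussianIntegrable_one.integrable_heatKernel n hθ y
  have hDe : D = fun w => (b - a) * (logPayoff f w * heatKernel 2 θ (y - w) -
        logPayoff f w * heatKernel 1 θ (y - w)) +
      ((f a - f b) * (Real.exp w * heatKernel 2 θ (y - w) - Real.exp w * heatKernel 1 θ (y - w)) +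
      (a * f b - b * f a) * (1 * heatKernel 2 θ (y - w) - 1 * heatKernel 1 θ (y - w))) := by
    ext w; simp only [D, H, logPayoff]; ring
  have hi₁ := ((i 2).sub (i 1)).const_mul (b - a)
  have hi₂ := ((j 2).sub (j 1)).const_mul (f a - f b)
  have hi₃ := ((k 2).sub (k 1)).const_mul (a * f b - b * f a)
  have hDi : Integrable D := by rw [hDe]; exact hi₁.add (hi₂.add hi₃)
  have hint : ∫ w, D w = (b - a) * (heatConv (logPayoff f) 2 θ y - heatConv (logPayoff f) 1 θ y) := by
    have e1 : ∫ w, (Real.exp w * heatKernel 2 θ (y - w) - Real.exp w * heatKernel 1 θ (y - w)) = 0 := by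
      rw [integral_sub (j 2) (j 1)]
      exact sub_eq_zero.2 ((heatConv_exp hθ 2 y).trans (heatConv_exp hθ 1 y).symm)
    have e2 : ∫ w, (1 * heatKernel 2 θ (y - w) - 1 * heatKernel 1 θ (y - w)) = 0 := by
      rw [integral_sub (k 2) (k 1)]
      exact sub_eq_zero.2 ((heatConv_one_succ hθ 1 y).trans (heatConv_one_succ hθ 0 y).symm)
    rw [hDe]
    have e3 := integral_add hi₁ (hi₂.add hi₃)
    have e4 := integral_add hi₂ hi₃
    simp only [Pi.add_apply, Pi.sub_apply] at e3 e4
    rw [e3, e4, integral_const_mul, integral_const_mul, integral_const_mul, e1, e2,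
      integral_sub (i 2) (i 1)]
    simp [heatConv]
  have hpos : 0 < ∫ w, D w := by
    -- otherwise the payoff coincides with its secant
    by_contra hcon
    have hz : ∫ w, D w = 0 := le_antisymm (not_lt.1 hcon) (integral_nonneg hD0)
    rw [integral_eq_zero_iff_of_nonneg hD0 hDi] at hz
    have hD00 : D = 0 := (Continuous.ae_eq_iff_eq volume hDc continuous_const).1 hz
    have hH : ∀ w, H (Real.exp w) = 0 := by
      intro w
      by_cases h1 : w = w₁
      · rw [h1]; simp only [H, a]; ring
      by_cases h2 : w = w₂
      · rw [h2]; simp only [H, b]; ring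
      have h3 := congrFun hD00 w
      rw [hD] at h3
      simpa [sub_eq_zero, h1, h2, hθ.ne', (heatKernel_zero_pos hθ (y - w)).ne'] using h3
    refine hne ⟨(f b - f a) / (b - a), (b * f a - a * f b) / (b - a), fun x hx => ?_⟩
    have h1 := hH (Real.log x)
    rw [Real.exp_log hx] at h1
    simp only [H] at h1
    have h2 : b - a ≠ 0 := (sub_pos.2 hab).ne'
    field_simp
    linarith
  rw [hint] at hpos
  exact sub_pos.1 ((pos_iff_pos_of_mul_pos hpos).1 (sub_pos.2 hab))

/-! ### Sums of increments along grids -/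

namespace TimeGrid

variable {a b : ℝ} (π : TimeGrid a b)

lemma time_mono {i j : ℕ} (hij : i ≤ j) (hj : j ≤ π.n) : π.time i ≤ π.time j := by
  induction j, hij using Nat.le_induction with
  | base => exact le_rfl
  | succ j _ ih => exact (ih (by lia)).trans (π.time_lt j (by lia)).le

lemma time_mem {k : ℕ} (hk : k ≤ π.n) : π.time k ∈ Icc a b := by
  constructor
  · simpa only [π.time_zero] using π.time_mono (Nat.zero_le k) hk
  · simpa only [π.time_last] using π.time_mono hk le_rfl

lemma sub_le_mesh {k : ℕ} (hk : k < π.n) : π.time (k + 1) - π.time k ≤ π.mesh :=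
  le_ciSup (f := fun k : Fin π.n => π.time ((k : ℕ) + 1) - π.time (k : ℕ))
    (Set.finite_range _).bddAbove ⟨k, hk⟩

lemma eventually_mesh_lt {δ : ℝ} (hδ : 0 < δ) :
    ∀ᶠ π : TimeGrid a b in comap TimeGrid.mesh (𝓝 0), π.mesh < δ :=
  tendsto_comap.eventually (gt_mem_nhds hδ)

/-- A grid of `[a, b]`, extended to a grid of `[a, c]` by the point `c`. -/
def extend {c : ℝ} (hc : b < c) : TimeGrid a c where
  n := π.n + 1
  time k := if k ≤ π.n then π.time k else c
  time_zero := by simp [π.time_zero]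
  time_last := by simp
  time_lt k hk := by
    rcases (Nat.lt_succ_iff.1 hk).eq_or_lt with rfl | h
    · simpa [π.time_last] using hc
    · simpa [h.le, Nat.succ_le_of_lt h] using π.time_lt k h

end TimeGrid

lemma IsCPVar.mono_right {p : ℝ} {X : ℝ → ℝ} {a b c : ℝ} (hX : IsCPVar p X a c) (hbc : b ≤ c) :
    IsCPVar p X a b := by
  rcases hbc.eq_or_lt with rfl | hbc
  · exact hX
  refine ⟨hX.1.mono (Icc_subset_Icc_right hbc.le), ?_⟩
  obtain ⟨W, hW⟩ := hX.2
  refine ⟨W, ?_⟩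
  rintro _ ⟨π, rfl⟩
  refine le_trans ?_ (hW ⟨π.extend hbc, rfl⟩)
  beta_reduce
  rw [show (π.extend hbc).n = π.n + 1 from rfl, Finset.sum_range_succ]
  refine le_trans (Finset.sum_le_sum fun k hk => le_of_eq ?_)
    (le_add_of_nonneg_right (by positivity))
  have hk := Finset.mem_range.1 hk
  simp [TimeGrid.extend, hk.le, Nat.succ_le_of_lt hk]

lemma eventually_abs_sub_lt {X : ℝ → ℝ} {a b : ℝ} (hX : ContinuousOn X (Icc a b)) {ε : ℝ}
    (hε : 0 < ε) : ∀ᶠ π : TimeGrid a b in comap TimeGrid.mesh (𝓝 0),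
      ∀ k < π.n, |X (π.time (k + 1)) - X (π.time k)| < ε := by
  obtain ⟨δ, hδ, h⟩ := Metric.uniformContinuousOn_iff.1
    (isCompact_Icc.uniformContinuousOn_of_continuous hX) ε hε
  filter_upwards [TimeGrid.eventually_mesh_lt hδ] with π hπ k hk
  refine h _ (π.time_mem hk) _ (π.time_mem hk.le) ?_
  rw [Real.dist_eq, abs_of_pos (sub_pos.2 (π.time_lt k hk))]
  exact (π.sub_le_mesh hk).trans_lt hπ

lemma tendsto_sum_rpow_zero {a b : ℝ} {c : TimeGrid a b → ℕ → ℝ} {W ρ : ℝ} (hρ : 1 < ρ)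
    (hc : ∀ π, ∀ k < π.n, 0 ≤ c π k) (hW : ∀ π, ∑ k ∈ Finset.range π.n, c π k ≤ W)
    (hsmall : ∀ ε > 0, ∀ᶠ π in comap TimeGrid.mesh (𝓝 0), ∀ k < π.n, c π k ≤ ε) :
    Tendsto (fun π => ∑ k ∈ Finset.range π.n, c π k ^ ρ) (comap TimeGrid.mesh (𝓝 0)) (𝓝 0) := by
  have hlim : Tendsto (fun ε : ℝ => ε ^ (ρ - 1) * W) (𝓝[>] 0) (𝓝 0) := by
    have : ContinuousAt (fun ε : ℝ => ε ^ (ρ - 1) * W) 0 :=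
      (Real.continuousAt_rpow_const 0 _ (Or.inr (by linarith))).mul continuousAt_const
    have := this.tendsto
    rw [Real.zero_rpow (by linarith), zero_mul] at this
    exact this.mono_left nhdsWithin_le_nhds
  refine Metric.tendsto_nhds.2 fun η hη => ?_
  obtain ⟨ε, hε, hε0⟩ := ((hlim.eventually (gt_mem_nhds hη)).and self_mem_nhdsWithin).exists
  filter_upwards [hsmall ε hε0] with π hπ
  have h0 : 0 ≤ ∑ k ∈ Finset.range π.n, c π k ^ ρ := Finset.sum_nonneg fun k hk =>
    Real.rpow_nonneg (hc π k (Finset.mem_range.1 hk)) _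
  rw [Real.dist_0_eq_abs, abs_of_nonneg h0]
  refine lt_of_le_of_lt ?_ hε
  calc ∑ k ∈ Finset.range π.n, c π k ^ ρ
      ≤ ∑ k ∈ Finset.range π.n, ε ^ (ρ - 1) * c π k := by
        refine Finset.sum_le_sum fun k hk => ?_
        have hk := Finset.mem_range.1 hk
        have h1 := hc π k hk
        have e : c π k ^ ρ = c π k ^ (ρ - 1) * c π k := by
          rw [← Real.rpow_add_one' h1 (by linarith)]; congr 1; ring
        rw [e]
        exact mul_le_mul_of_nonneg_right
          (Real.rpow_le_rpow h1 (hπ k hk) (by linarith)) h1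
    _ ≤ ε ^ (ρ - 1) * W := by
        rw [← Finset.mul_sum]
        exact mul_le_mul_of_nonneg_left (hW π) (Real.rpow_nonneg (le_of_lt hε0) _)

/-- The third-order remainders of a path `y` controlled by `S`, `σ` and time, and of a path `θ`
controlled by `σ` and time only, are negligible: each of them is bounded by a power larger than `1`
of the control `|δS|^p + |δσ|^q + δt`, whose sums over grids are bounded. -/
lemma tendsto_sum_remainder {a b p q : ℝ} (hp : 1 ≤ p) (hp3 : p < 3) (hq : 1 ≤ q) (hq2 : q < 2)
    (hpq : 1 < 1 / p + 1 / q) {S σ y θ : ℝ → ℝ} (hS : IsCPVar p S a b) (hσ : IsCPVar q σ a b)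
    {K : ℝ} (hK : 0 ≤ K)
    (hy : ∀ s ∈ Icc a b, ∀ s' ∈ Icc a b, |y s' - y s| ≤
      K * (|S s' - S s| + (|σ s' - σ s| + |s' - s|)))
    (hθ : ∀ s ∈ Icc a b, ∀ s' ∈ Icc a b, |θ s' - θ s| ≤ K * (|σ s' - σ s| + |s' - s|)) :
    Tendsto (fun π : TimeGrid a b => ∑ k ∈ Finset.range π.n,
      (|y (π.time (k + 1)) - y (π.time k)| ^ 3 +
        |y (π.time (k + 1)) - y (π.time k)| * |θ (π.time (k + 1)) - θ (π.time k)| +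
        |θ (π.time (k + 1)) - θ (π.time k)| ^ 2)) (comap TimeGrid.mesh (𝓝 0)) (𝓝 0) := by
  have hp0 : 0 < p := by linarith
  have hq0 : 0 < q := by linarith
  let dS : TimeGrid a b → ℕ → ℝ := fun π k => |S (π.time (k + 1)) - S (π.time k)|
  let dσ : TimeGrid a b → ℕ → ℝ := fun π k => |σ (π.time (k + 1)) - σ (π.time k)|
  let dt : TimeGrid a b → ℕ → ℝ := fun π k => |π.time (k + 1) - π.time k|
  let c : TimeGrid a b → ℕ → ℝ := fun π k => dS π k ^ p + dσ π k ^ q + dt π k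
  have hdS : ∀ π k, 0 ≤ dS π k := fun _ _ => abs_nonneg _
  have hdσ : ∀ π k, 0 ≤ dσ π k := fun _ _ => abs_nonneg _
  have hdt : ∀ π k, 0 ≤ dt π k := fun _ _ => abs_nonneg _
  have hc : ∀ π k, 0 ≤ c π k := fun π k =>
    add_nonneg (add_nonneg (Real.rpow_nonneg (hdS π k) _) (Real.rpow_nonneg (hdσ π k) _)) (hdt π k)
  obtain ⟨W₁, hW₁⟩ := hS.2
  obtain ⟨W₂, hW₂⟩ := hσ.2
  have hW : ∀ π : TimeGrid a b, ∑ k ∈ Finset.range π.n, c π k ≤ W₁ + W₂ + (b - a) := by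
    intro π
    have h1 : ∑ k ∈ Finset.range π.n, dt π k = b - a := by
      have h2 := Finset.sum_range_sub π.time π.n
      rw [π.time_zero, π.time_last] at h2
      rw [← h2]
      exact Finset.sum_congr rfl fun k hk =>
        abs_of_pos (sub_pos.2 (π.time_lt k (Finset.mem_range.1 hk)))
    simp only [c, Finset.sum_add_distrib, h1]
    exact add_le_add_left (add_le_add (hW₁ ⟨π, rfl⟩) (hW₂ ⟨π, rfl⟩)) _
  have hsmall : ∀ ε > 0, ∀ᶠ π in comap TimeGrid.mesh (𝓝 0), ∀ k < π.n, c π k ≤ ε := by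
    intro ε hε
    have hε3 : 0 < ε / 3 := by positivity
    filter_upwards [eventually_abs_sub_lt hS.1 (Real.rpow_pos_of_pos hε3 (1 / p)),
      eventually_abs_sub_lt hσ.1 (Real.rpow_pos_of_pos hε3 (1 / q)),
      eventually_abs_sub_lt (continuousOn_id (s := Icc a b)) hε3] with π h1 h2 h3 k hk
    have e1 : dS π k ^ p ≤ ε / 3 := by
      have := Real.rpow_le_rpow (hdS π k) (h1 k hk).le hp0.le
      rwa [← Real.rpow_mul hε3.le, one_div_mul_cancel hp0.ne', Real.rpow_one] at this
    have e2 : dσ π k ^ q ≤ ε / 3 := by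
      have := Real.rpow_le_rpow (hdσ π k) (h2 k hk).le hq0.le
      rwa [← Real.rpow_mul hε3.le, one_div_mul_cancel hq0.ne', Real.rpow_one] at this
    have e3 : dt π k ≤ ε / 3 := (h3 k hk).le
    simp only [c]; linarith
  set ρ := min (3 / p) (min (2 / q) (1 / p + 1 / q)) with hρ_def
  have hρ : 1 < ρ := by
    rw [hρ_def, lt_min_iff, lt_min_iff]
    exact ⟨(one_lt_div hp0).2 hp3, (one_lt_div hq0).2 hq2, hpq⟩
  have hlim := (tendsto_sum_rpow_zero hρ (fun π k _ => hc π k) hW hsmall).const_mul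
    ((2 * K) ^ 3 * 8 + (2 * K) ^ 2 * 3)
  rw [mul_zero] at hlim
  refine squeeze_zero' (Eventually.of_forall fun π => Finset.sum_nonneg fun k _ => by positivity)
    ?_ hlim
  filter_upwards [hsmall 1 one_pos] with π hπ
  rw [Finset.mul_sum]
  refine Finset.sum_le_sum fun k hk => ?_
  have hk := Finset.mem_range.1 hk
  have hc0 := hc π k
  have hc1 := hπ k hk
  -- `u` and `z` bound the increments of `S` and of `σ`, up to constants
  set u := c π k ^ (1 / p)
  set z := c π k ^ (1 / q)
  have hu : 0 ≤ u := Real.rpow_nonneg hc0 _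
  have hz : 0 ≤ z := Real.rpow_nonneg hc0 _
  have hz1 : z ≤ 1 := Real.rpow_le_one hc0 hc1 (by positivity)
  have huS : dS π k ≤ u := by
    have h1 : dS π k ^ p ≤ c π k := by
      have := Real.rpow_nonneg (hdσ π k) q
      have := hdt π k
      simp only [c]; linarith
    have := Real.rpow_le_rpow (Real.rpow_nonneg (hdS π k) _) h1 (by positivity : 0 ≤ 1 / p)
    rwa [← Real.rpow_mul (hdS π k), mul_one_div_cancel hp0.ne', Real.rpow_one] at this
  have hzσ : dσ π k ≤ z := by
    have h1 : dσ π k ^ q ≤ c π k := by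
      have := Real.rpow_nonneg (hdS π k) p
      have := hdt π k
      simp only [c]; linarith
    have := Real.rpow_le_rpow (Real.rpow_nonneg (hdσ π k) _) h1 (by positivity : 0 ≤ 1 / q)
    rwa [← Real.rpow_mul (hdσ π k), mul_one_div_cancel hq0.ne', Real.rpow_one] at this
  have hzt : dt π k ≤ z := by
    have h1 : dt π k ≤ c π k := by
      have := Real.rpow_nonneg (hdσ π k) q
      have := Real.rpow_nonneg (hdS π k) p
      simp only [c]; linarith
    have h2 : c π k ≤ z := by
      have := Real.rpow_le_rpow_of_exponent_ge' hc0 hc1 (by positivity : 0 ≤ 1 / q)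
        ((div_le_one hq0).2 hq)
      rwa [Real.rpow_one] at this
    exact h1.trans h2
  have hpow : ∀ r : ℝ, ρ ≤ r → c π k ^ r ≤ c π k ^ ρ := fun r hr =>
    Real.rpow_le_rpow_of_exponent_ge' hc0 hc1 (by linarith) hr
  have hu3 : u ^ 3 ≤ c π k ^ ρ := by
    rw [← Real.rpow_natCast u, ← Real.rpow_mul hc0]
    refine hpow _ ((min_le_left _ _).trans (le_of_eq ?_))
    push_cast; ring
  have hz2 : z ^ 2 ≤ c π k ^ ρ := by
    rw [← Real.rpow_natCast z, ← Real.rpow_mul hc0]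
    refine hpow _ (((min_le_right _ _).trans (min_le_left _ _)).trans (le_of_eq ?_))
    push_cast; ring
  have huz : u * z ≤ c π k ^ ρ := by
    rw [← Real.rpow_add' hc0 (by positivity)]
    exact hpow _ ((min_le_right _ _).trans (min_le_right _ _))
  have hz3 : z ^ 3 ≤ c π k ^ ρ :=
    (pow_le_pow_of_le_one hz hz1 (by norm_num)).trans hz2
  have hmem := π.time_mem hk.le
  have hmem' := π.time_mem (Nat.succ_le_of_lt hk)
  have hθ' : |θ (π.time (k + 1)) - θ (π.time k)| ≤ 2 * K * z := by
    refine (hθ _ hmem _ hmem').trans ?_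
    calc K * (dσ π k + dt π k) ≤ K * (z + z) := by gcongr
      _ = 2 * K * z := by ring
  have hy' : |y (π.time (k + 1)) - y (π.time k)| ≤ 2 * K * (u + z) := by
    refine (hy _ hmem _ hmem').trans ?_
    calc K * (dS π k + (dσ π k + dt π k)) ≤ K * (2 * u + (z + z)) := by gcongr; linarith
      _ = 2 * K * (u + z) := by ring
  have hcube : (u + z) ^ 3 ≤ 8 * c π k ^ ρ := by
    have : (u + z) ^ 3 ≤ 4 * (u ^ 3 + z ^ 3) := by
      nlinarith [mul_nonneg (add_nonneg hu hz) (sq_nonneg (u - z))]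
    linarith
  calc _ ≤ (2 * K * (u + z)) ^ 3 + 2 * K * (u + z) * (2 * K * z) + (2 * K * z) ^ 2 := by gcongr
    _ = (2 * K) ^ 3 * (u + z) ^ 3 + (2 * K) ^ 2 * (u * z + z ^ 2 + z ^ 2) := by ring
    _ ≤ (2 * K) ^ 3 * (8 * c π k ^ ρ) +
        (2 * K) ^ 2 * (c π k ^ ρ + c π k ^ ρ + c π k ^ ρ) := by gcongr
    _ = _ := by ring

/-! ### The profit and loss of the gamma hedge -/

lemma wealth_eq_sum {a b : ℝ} (π : TimeGrid a b) (w₀ : ℝ) (P S : ℝ → ℝ) (q : ℝ → ℝ × ℝ) (n : ℕ) :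
    wealth π w₀ P S q n = w₀ + ∑ k ∈ Finset.range n,
      ((q (π.time k)).1 * (P (π.time (k + 1)) - P (π.time k)) +
        (q (π.time k)).2 * (S (π.time (k + 1)) - S (π.time k))) := by
  induction n with
  | zero => simp [wealth]
  | succ n ih => rw [wealth, ih, Finset.sum_range_succ]; ring

/-- The stock price itself, as a function of `θ` and `y`. -/
lemma isHeatTower_exp (J : Set ℝ) : IsHeatTower (fun _ θ y => Real.exp (y + θ / 2)) J where
  hasDerivAt_space _ θ _ y := by simpa using ((hasDerivAt_id y).add_const (θ / 2)).exp
  hasDerivAt_time _ θ _ y := by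
    refine ((((hasDerivAt_id θ).div_const 2).const_add y).exp).congr_deriv ?_
    simp; ring
  continuousOn _ := by fun_prop

lemma abs_log_sub_log_le {m x x' : ℝ} (hm : 0 < m) (hx : m ≤ x) (hx' : m ≤ x') :
    |Real.log x' - Real.log x| ≤ m⁻¹ * |x' - x| := by
  have key : ∀ x x' : ℝ, m ≤ x → m ≤ x' → Real.log x' - Real.log x ≤ m⁻¹ * |x' - x| := by
    intro x x' hx hx'
    have h0 : 0 < x := hm.trans_le hx
    rw [← Real.log_div (hm.trans_le hx').ne' h0.ne']
    refine (Real.log_le_sub_one_of_pos (div_pos (hm.trans_le hx') h0)).trans ?_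
    calc x' / x - 1 = x⁻¹ * (x' - x) := by field_simp
      _ ≤ x⁻¹ * |x' - x| := by gcongr; exact le_abs_self _
      _ ≤ m⁻¹ * |x' - x| := by gcongr
  rw [abs_le]
  constructor
  · have := key x' x hx' hx
    rw [abs_sub_comm] at this
    linarith
  · exact key x x' hx hx'

lemma isClassicalGammaHedge_iff {f₀ f₁ : ℝ → ℝ} {x v τ : ℝ} (h : bsGamma f₁ x v τ ≠ 0)
    (q : ℝ × ℝ) : IsClassicalGammaHedge f₀ f₁ x v τ q ↔
      q.1 = bsGamma f₀ x v τ / bsGamma f₁ x v τ ∧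
        q.2 = bsDelta f₀ x v τ - q.1 * bsDelta f₁ x v τ := by
  rw [IsClassicalGammaHedge, mul_zero, add_zero, mul_one, eq_div_iff h, and_comm, eq_sub_iff_add_eq']

/-- The increments of the total implied variance `θ = σ² (T - s)` and of `y = log S - θ / 2`. -/
lemma exists_increment_bound {T t : ℝ} (htT : t ≤ T) {S σ : ℝ → ℝ}
    (hS : ContinuousOn S (Icc 0 t)) (hSpos : ∀ s ∈ Icc 0 t, 0 < S s)
    (hσ : ContinuousOn σ (Icc 0 t)) : ∃ K : ℝ, 0 ≤ K ∧
    (∀ s ∈ Icc 0 t, ∀ s' ∈ Icc 0 t,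
      |(Real.log (S s') - σ s' ^ 2 * (T - s') / 2) - (Real.log (S s) - σ s ^ 2 * (T - s) / 2)| ≤
      K * (|S s' - S s| + (|σ s' - σ s| + |s' - s|))) ∧
    (∀ s ∈ Icc 0 t, ∀ s' ∈ Icc 0 t,
      |σ s' ^ 2 * (T - s') - σ s ^ 2 * (T - s)| ≤ K * (|σ s' - σ s| + |s' - s|)) := by
  rcases lt_or_ge t 0 with ht | ht
  · refine ⟨0, le_rfl, fun s hs => ?_, fun s hs => ?_⟩ <;>
      exact absurd (hs.1.trans hs.2) (not_le.2 ht)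
  obtain ⟨s₀, hs₀, hmin⟩ := isCompact_Icc.exists_isMinOn (nonempty_Icc.2 ht) hS
  have hm := hSpos s₀ hs₀
  obtain ⟨B, hB⟩ := isCompact_Icc.exists_bound_of_continuousOn hσ
  have hB0 : 0 ≤ B := (norm_nonneg _).trans (hB s₀ hs₀)
  have hT : 0 ≤ T := ht.trans htT
  have hθ : ∀ s ∈ Icc 0 t, ∀ s' ∈ Icc 0 t, |σ s' ^ 2 * (T - s') - σ s ^ 2 * (T - s)| ≤
      (2 * B * T + B ^ 2) * (|σ s' - σ s| + |s' - s|) := by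
    intro s hs s' hs'
    have e : σ s' ^ 2 * (T - s') - σ s ^ 2 * (T - s) =
        (σ s' + σ s) * (T - s') * (σ s' - σ s) - σ s ^ 2 * (s' - s) := by ring
    have h1 : |σ s| ≤ B := hB s hs
    have h2 : |σ s'| ≤ B := hB s' hs'
    have h3 : |T - s'| ≤ T := by
      rw [abs_of_nonneg (by linarith [hs'.2])]; linarith [hs'.1]
    rw [e]
    calc _ ≤ |(σ s' + σ s) * (T - s') * (σ s' - σ s)| + |σ s ^ 2 * (s' - s)| := abs_sub _ _
      _ = |σ s' + σ s| * |T - s'| * |σ s' - σ s| + |σ s| ^ 2 * |s' - s| := by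
        rw [abs_mul, abs_mul, abs_mul, abs_pow]
      _ ≤ (2 * B) * T * |σ s' - σ s| + B ^ 2 * |s' - s| := by
        gcongr
        exact (abs_add_le _ _).trans (by linarith)
      _ ≤ _ := by
        have h4 : 0 ≤ B ^ 2 * |σ s' - σ s| := by positivity
        have h5 : 0 ≤ 2 * B * T * |s' - s| := by positivity
        linarith
  refine ⟨(S s₀)⁻¹ + (2 * B * T + B ^ 2), by positivity, fun s hs s' hs' => ?_,
    fun s hs s' hs' => (hθ s hs s' hs').trans ?_⟩
  · have h1 := abs_log_sub_log_le hm (hmin hs) (hmin hs')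
    have h2 := hθ s hs s' hs'
    have e : (Real.log (S s') - σ s' ^ 2 * (T - s') / 2) -
        (Real.log (S s) - σ s ^ 2 * (T - s) / 2) = (Real.log (S s') - Real.log (S s)) -
        (σ s' ^ 2 * (T - s') - σ s ^ 2 * (T - s)) / 2 := by ring
    rw [e]
    refine (abs_sub _ _).trans ?_
    rw [abs_div, abs_two]
    have h3 := abs_nonneg (σ s' ^ 2 * (T - s') - σ s ^ 2 * (T - s))
    have h4 : 0 ≤ (S s₀)⁻¹ * (|σ s' - σ s| + |s' - s|) := by positivity
    have h5 : 0 ≤ (2 * B * T + B ^ 2) * |S s' - S s| := by positivity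
    linarith
  · have h4 : 0 ≤ (S s₀)⁻¹ * (|σ s' - σ s| + |s' - s|) := by positivity
    linarith

/-- Gamma hedging replicates as soon as the payoffs are regular enough on the range of the total
implied variance and the gamma of the option does not vanish along the path: at each trading time
the hedged position has vanishing first and second derivatives, hence, by the heat equation, also
a vanishing derivative with respect to the total variance. -/
theorem gammaHedgingReplicates_of_isHeatTower {T t : ℝ} (ht0 : 0 ≤ t) (htT : t ≤ T)
    {p q : ℝ} (hp : 1 ≤ p) (hp3 : p < 3) (hq : 1 ≤ q) (hq2 : q < 2) (hpq : 1 < 1 / p + 1 / q)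
    {S σ : ℝ → ℝ} (hS : IsCPVar p S 0 t) (hSpos : ∀ s ∈ Icc 0 t, 0 < S s) (hσ : IsCPVar q σ 0 t)
    {f₀ f₁ P : ℝ → ℝ} (hf₀ : ContinuousOn f₀ (Ioi 0)) (hf₁ : ContinuousOn f₁ (Ioi 0))
    (hP : ∀ s ∈ Icc 0 t, P s = bsPrice f₁ (S s) (σ s) (T - s))
    {m M : ℝ} (hm : 0 ≤ m) (hθ : ∀ s ∈ Icc 0 t, σ s ^ 2 * (T - s) ∈ Icc m M)
    (hG₀ : IsHeatTower (heatFlow (logPayoff f₀)) (Icc m M))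
    (hG₁ : IsHeatTower (heatFlow (logPayoff f₁)) (Icc m M))
    (hΓ : ∀ s ∈ Icc 0 t, bsGamma f₁ (S s) (σ s) (T - s) ≠ 0) :
    GammaHedgingReplicates f₀ f₁ P S σ T t (bsPrice f₀ (S t) (σ t) (T - t)) := by
  have hτ : ∀ s ∈ Icc 0 t, 0 ≤ T - s := fun s hs => by linarith [hs.2]
  refine ⟨fun s hs => ⟨contDiffAt_bsPrice hf₀ hG₀ (hτ s hs) (hθ s hs) (hSpos s hs),
    contDiffAt_bsPrice hf₁ hG₁ (hτ s hs) (hθ s hs) (hSpos s hs), ?_⟩, fun Q hQ => ?_⟩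
  · simp only [isClassicalGammaHedge_iff (hΓ s hs)]
    refine ⟨(bsGamma f₀ (S s) (σ s) (T - s) / bsGamma f₁ (S s) (σ s) (T - s),
      bsDelta f₀ (S s) (σ s) (T - s) - bsGamma f₀ (S s) (σ s) (T - s) /
        bsGamma f₁ (S s) (σ s) (T - s) * bsDelta f₁ (S s) (σ s) (T - s)), ⟨rfl, rfl⟩, ?_⟩
    rintro ⟨q₁, q₂⟩ ⟨h₁, h₂⟩
    simp only at h₁ h₂
    rw [h₂, h₁]
  set θ : ℝ → ℝ := fun s => σ s ^ 2 * (T - s) with hθ_def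
  set y : ℝ → ℝ := fun s => Real.log (S s) - σ s ^ 2 * (T - s) / 2 with hy_def
  have hθc : ContinuousOn θ (Icc 0 t) := (hσ.1.pow 2).mul (by fun_prop)
  have hyc : ContinuousOn y (Icc 0 t) :=
    (hS.1.log fun s hs => (hSpos s hs).ne').sub (hθc.div_const 2)
  obtain ⟨B, hB⟩ := isCompact_Icc.exists_bound_of_continuousOn hyc
  have hyI : ∀ s ∈ Icc 0 t, y s ∈ Icc (-B) B := fun s hs => abs_le.1 (hB s hs)
  have hpath : ∀ {G : ℕ → ℝ → ℝ → ℝ}, IsHeatTower G (Icc m M) → ∀ n,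
      ContinuousOn (fun s => G n (θ s) (y s)) (Icc 0 t) := fun hG n =>
    (hG.continuousOn n).comp (hyc.prodMk hθc) fun s hs => ⟨mem_univ _, hθ s hs⟩
  set h : ℕ → ℝ → ℝ := fun n s => heatFlow (logPayoff f₀) n (θ s) (y s)
  set k : ℕ → ℝ → ℝ := fun n s => heatFlow (logPayoff f₁) n (θ s) (y s)
  have hk : ∀ s ∈ Icc 0 t, k 2 s - k 1 s ≠ 0 := by
    intro s hs h0
    apply hΓ s hs
    rw [bsGamma_eq hf₁ hG₁ (hτ s hs) (hθ s hs) (hSpos s hs)]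
    exact div_eq_zero_iff.2 (Or.inl h0)
  -- the matching conditions in terms of the variables `y` and `θ`
  have hQ₁ : ∀ s ∈ Icc 0 t, (Q s).1 * (k 2 s - k 1 s) = h 2 s - h 1 s := by
    intro s hs
    have := (hQ s hs).2
    rw [bsGamma_eq hf₁ hG₁ (hτ s hs) (hθ s hs) (hSpos s hs),
      bsGamma_eq hf₀ hG₀ (hτ s hs) (hθ s hs) (hSpos s hs), mul_zero, add_zero, ← mul_div_assoc,
      div_left_inj' (pow_ne_zero 2 (hSpos s hs).ne')] at this
    exact this
  have hQ₂ : ∀ s ∈ Icc 0 t, (Q s).1 * k 1 s + (Q s).2 * S s = h 1 s := by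
    intro s hs
    have h0 := (hSpos s hs).ne'
    have h1 : (Q s).1 * (k 1 s / S s) + (Q s).2 * 1 = h 1 s / S s := by
      have := (hQ s hs).1
      rw [bsDelta_eq hf₁ hG₁ (hτ s hs) (hθ s hs) (hSpos s hs),
        bsDelta_eq hf₀ hG₀ (hτ s hs) (hθ s hs) (hSpos s hs)] at this
      exact this
    calc (Q s).1 * k 1 s + (Q s).2 * S s = ((Q s).1 * (k 1 s / S s) + (Q s).2 * 1) * S s := by
          field_simp
      _ = h 1 s := by rw [h1, div_mul_cancel₀ _ h0]
  obtain ⟨B₁, hB₁⟩ := isCompact_Icc.exists_bound_of_continuousOn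
    (((hpath hG₀ 2).sub (hpath hG₀ 1)).div ((hpath hG₁ 2).sub (hpath hG₁ 1)) hk)
  have hQB₁ : ∀ s ∈ Icc 0 t, |(Q s).1| ≤ B₁ := fun s hs => by
    rw [eq_div_of_mul_eq (hk s hs) (hQ₁ s hs)]
    exact hB₁ s hs
  obtain ⟨B₂, hB₂⟩ := isCompact_Icc.exists_bound_of_continuousOn
    (((hpath hG₀ 1).sub ((((hpath hG₀ 2).sub (hpath hG₀ 1)).div
      ((hpath hG₁ 2).sub (hpath hG₁ 1)) hk).mul (hpath hG₁ 1))).div hS.1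
      fun s hs => (hSpos s hs).ne')
  have hQB₂ : ∀ s ∈ Icc 0 t, |(Q s).2| ≤ B₂ := fun s hs => by
    have e : (Q s).2 = (h 1 s - (h 2 s - h 1 s) / (k 2 s - k 1 s) * k 1 s) / S s := by
      rw [← eq_div_of_mul_eq (hk s hs) (hQ₁ s hs), eq_div_iff (hSpos s hs).ne']
      linarith [hQ₂ s hs]
    rw [e]
    exact hB₂ s hs
  have h0t : (0 : ℝ) ∈ Icc 0 t := ⟨le_rfl, ht0⟩
  have hB₁0 : 0 ≤ B₁ := (abs_nonneg _).trans (hQB₁ 0 h0t)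
  have hB₂0 : 0 ≤ B₂ := (abs_nonneg _).trans (hQB₂ 0 h0t)
  obtain ⟨C₀, hC₀, t₀⟩ := hG₀.exists_taylor_bound (α := -B) (β := B) hm subset_rfl
  obtain ⟨C₁, hC₁, t₁⟩ := hG₁.exists_taylor_bound (α := -B) (β := B) hm subset_rfl
  obtain ⟨C₂, hC₂, t₂⟩ := (isHeatTower_exp (Icc m M)).exists_taylor_bound
    (α := -B) (β := B) hm subset_rfl
  have hSexp : ∀ s ∈ Icc 0 t, S s = Real.exp (y s + θ s / 2) := fun s hs => by
    rw [hy_def, hθ_def]; simp only [sub_add_cancel]; exact (Real.exp_log (hSpos s hs)).symm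
  have hV₀ : ∀ s ∈ Icc 0 t, bsPrice f₀ (S s) (σ s) (T - s) = h 0 s := fun s hs =>
    bsPrice_eq_heatFlow hf₀ (hSpos s hs) (σ s) (hτ s hs)
  have hV₁ : ∀ s ∈ Icc 0 t, P s = k 0 s := fun s hs => by
    rw [hP s hs]; exact bsPrice_eq_heatFlow hf₁ (hSpos s hs) (σ s) (hτ s hs)
  have hstep : ∀ s ∈ Icc 0 t, ∀ s' ∈ Icc 0 t,
      |(Q s).1 * (P s' - P s) + (Q s).2 * (S s' - S s) - (h 0 s' - h 0 s)| ≤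
        (B₁ * C₁ + B₂ * C₂ + C₀) *
        (|y s' - y s| ^ 3 + |y s' - y s| * |θ s' - θ s| + |θ s' - θ s| ^ 2) := by
    intro s hs s' hs'
    have r₀ := t₀ _ (hyI s hs) _ (hyI s' hs') _ (hθ s hs) _ (hθ s' hs')
    have r₁ := t₁ _ (hyI s hs) _ (hyI s' hs') _ (hθ s hs) _ (hθ s' hs')
    have r₂ := t₂ _ (hyI s hs) _ (hyI s' hs') _ (hθ s hs) _ (hθ s' hs')
    change |h 0 s' - h 0 s - h 1 s * (y s' - y s) -
      h 2 s * ((y s' - y s) ^ 2 + (θ s' - θ s)) / 2| ≤ C₀ *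
        (|y s' - y s| ^ 3 + |y s' - y s| * |θ s' - θ s| + |θ s' - θ s| ^ 2) at r₀
    change |k 0 s' - k 0 s - k 1 s * (y s' - y s) -
      k 2 s * ((y s' - y s) ^ 2 + (θ s' - θ s)) / 2| ≤ C₁ *
        (|y s' - y s| ^ 3 + |y s' - y s| * |θ s' - θ s| + |θ s' - θ s| ^ 2) at r₁
    change |Real.exp (y s' + θ s' / 2) - Real.exp (y s + θ s / 2) -
      Real.exp (y s + θ s / 2) * (y s' - y s) -
      Real.exp (y s + θ s / 2) * ((y s' - y s) ^ 2 + (θ s' - θ s)) / 2| ≤ C₂ *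
        (|y s' - y s| ^ 3 + |y s' - y s| * |θ s' - θ s| + |θ s' - θ s| ^ 2) at r₂
    rw [← hSexp s hs, ← hSexp s' hs'] at r₂
    rw [hV₁ s hs, hV₁ s' hs']
    set E := |y s' - y s| ^ 3 + |y s' - y s| * |θ s' - θ s| + |θ s' - θ s| ^ 2
    set R₀ := h 0 s' - h 0 s - h 1 s * (y s' - y s) -
      h 2 s * ((y s' - y s) ^ 2 + (θ s' - θ s)) / 2 with hR₀
    set R₁ := k 0 s' - k 0 s - k 1 s * (y s' - y s) -
      k 2 s * ((y s' - y s) ^ 2 + (θ s' - θ s)) / 2 with hR₁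
    set R₂ := S s' - S s - S s * (y s' - y s) -
      S s * ((y s' - y s) ^ 2 + (θ s' - θ s)) / 2 with hR₂
    have e : (Q s).1 * (k 0 s' - k 0 s) + (Q s).2 * (S s' - S s) - (h 0 s' - h 0 s) =
        (Q s).1 * R₁ + (Q s).2 * R₂ - R₀ := by
      rw [hR₀, hR₁, hR₂]
      linear_combination (y s' - y s) * hQ₂ s hs +
        ((y s' - y s) ^ 2 + (θ s' - θ s)) / 2 * (hQ₁ s hs + hQ₂ s hs)
    rw [e]
    calc |(Q s).1 * R₁ + (Q s).2 * R₂ - R₀| ≤ |(Q s).1| * |R₁| + |(Q s).2| * |R₂| + |R₀| := by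
          rw [← abs_mul, ← abs_mul]
          exact (abs_sub _ _).trans (add_le_add_left (abs_add_le _ _) _)
      _ ≤ B₁ * (C₁ * E) + B₂ * (C₂ * E) + C₀ * E := by
          gcongr
          exacts [hQB₁ s hs, hQB₂ s hs]
      _ = _ := by ring
  obtain ⟨K, hK, hKy, hKθ⟩ := exists_increment_bound htT hS.1 hSpos hσ.1
  have hlim := (tendsto_sum_remainder hp hp3 hq hq2 hpq hS hσ hK hKy hKθ).const_mul
    (B₁ * C₁ + B₂ * C₂ + C₀)
  rw [mul_zero] at hlim
  refine squeeze_zero_norm (fun π => ?_) hlim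
  have e : wealth π (bsPrice f₀ (S 0) (σ 0) T) P S Q π.n - bsPrice f₀ (S t) (σ t) (T - t) =
      ∑ j ∈ Finset.range π.n,
        ((Q (π.time j)).1 * (P (π.time (j + 1)) - P (π.time j)) +
          (Q (π.time j)).2 * (S (π.time (j + 1)) - S (π.time j)) -
          (h 0 (π.time (j + 1)) - h 0 (π.time j))) := by
    have h1 := hV₀ 0 h0t
    rw [sub_zero] at h1
    rw [wealth_eq_sum, h1, hV₀ t ⟨ht0, le_rfl⟩, Finset.sum_sub_distrib,
      Finset.sum_range_sub (fun j => h 0 (π.time j)), π.time_zero, π.time_last]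
    ring
  rw [e, Finset.mul_sum]
  refine (norm_sum_le _ _).trans (Finset.sum_le_sum fun j hj => ?_)
  have hj := Finset.mem_range.1 hj
  exact hstep _ (π.time_mem hj.le) _ (π.time_mem hj)

/-! ### Convex payoffs and smooth payoffs -/

lemma bsPrice_zero_time (f : ℝ → ℝ) (x v : ℝ) : bsPrice f x v 0 = f x := by
  simp [bsPrice, gbm]

lemma bsGamma_pos_of_convexOn {f : ℝ → ℝ} (hf : ConvexOn ℝ (Ioi 0) f)
    (hne : ¬ ∃ a b : ℝ, ∀ x : ℝ, 0 < x → f x = a * x + b) (hprice : HasBSPrice f)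
    {x v τ : ℝ} (hx : 0 < x) (hv : 0 < v) (hτ : 0 < τ) : 0 < bsGamma f x v τ := by
  have hc := hf.continuousOn isOpen_Ioi
  have hg := hprice.gaussianIntegrable hc
  have hθ : 0 < v ^ 2 * τ := by positivity
  rw [bsGamma_eq hc hg.isHeatTower hτ.le hθ hx, heatFlow_of_pos _ _ hθ, heatFlow_of_pos _ _ hθ]
  exact div_pos (sub_pos.2 (heatConv_one_lt_two_of_convexOn hf hne hg hθ _)) (by positivity)

lemma isHeatTower_of_contDiffOn {f : ℝ → ℝ} (hf : ContDiffOn ℝ ∞ f (Ioi 0))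
    (hprice : HasBSPrice f) : IsHeatTower (heatFlow (logPayoff f)) (Ici 0) :=
  (hprice.gaussianIntegrable hf.continuousOn).isHeatTower_of_contDiff
    (hf.comp_contDiff Real.contDiff_exp Real.exp_pos)

end GammaHedging

end

theorem mainTheorem3
    (T : ℝ) (hT : 0 < T)
    (p q : ℝ) (hp : 1 ≤ p) (hp3 : p < 3) (hq : 1 ≤ q) (hq2 : q < 2) (hpq : 1 < 1 / p + 1 / q)
    (S σ : ℝ → ℝ)
    (hS : GammaHedging.IsCPVar p S 0 T) (hSpos : ∀ t ∈ Set.Icc 0 T, 0 < S t)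
    (hσ : GammaHedging.IsCPVar q σ 0 T) (hσpos : ∀ t ∈ Set.Icc 0 T, 0 < σ t)
    (f₁ : ℝ → ℝ) (hf₁ : ConvexOn ℝ (Set.Ioi 0) f₁)
    (hf₁_nonlin : ¬ ∃ a b : ℝ, ∀ x : ℝ, 0 < x → f₁ x = a * x + b)
    (hf₁_price : GammaHedging.HasBSPrice f₁)
    (P : ℝ → ℝ)
    (hP : ∀ t ∈ Set.Icc 0 T, P t = GammaHedging.bsPrice f₁ (S t) (σ t) (T - t))
    (f₀ : ℝ → ℝ) (hf₀ : ContDiffOn ℝ ∞ f₀ (Set.Ioi 0))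
    (hf₀_price : GammaHedging.HasBSPrice f₀) :
    (∀ t ∈ Set.Ico 0 T,
      GammaHedging.GammaHedgingReplicates f₀ f₁ P S σ T t
        (GammaHedging.bsPrice f₀ (S t) (σ t) (T - t))) ∧
    (ContDiffOn ℝ ∞ f₁ (Set.Ioi 0) → (∀ x : ℝ, 0 < x → 0 < deriv (deriv f₁) x) →
      GammaHedging.GammaHedgingReplicates f₀ f₁ P S σ T T (f₀ (S T))) := by
  have hf₁c := hf₁.continuousOn isOpen_Ioi
  have hG₀ := GammaHedging.isHeatTower_of_contDiffOn hf₀ hf₀_price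
  have hΓ : ∀ s ∈ Set.Ico 0 T, 0 < GammaHedging.bsGamma f₁ (S s) (σ s) (T - s) := fun s hs =>
    GammaHedging.bsGamma_pos_of_convexOn hf₁ hf₁_nonlin hf₁_price
      (hSpos s (Set.Ico_subset_Icc_self hs)) (hσpos s (Set.Ico_subset_Icc_self hs))
      (sub_pos.2 hs.2)
  have hθc : ContinuousOn (fun s => σ s ^ 2 * (T - s)) (Set.Icc 0 T) :=
    (hσ.1.pow 2).mul (by fun_prop)
  obtain ⟨M, hM⟩ := isCompact_Icc.exists_bound_of_continuousOn hθc
  have hθM : ∀ s ∈ Set.Icc 0 T, σ s ^ 2 * (T - s) ≤ M := fun s hs =>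
    (le_abs_self _).trans (hM s hs)
  constructor
  · intro t ht
    have hsub : Set.Icc 0 t ⊆ Set.Icc 0 T := Set.Icc_subset_Icc_right ht.2.le
    have hsub' : ∀ s ∈ Set.Icc 0 t, s ∈ Set.Ico 0 T := fun s hs => ⟨hs.1, hs.2.trans_lt ht.2⟩
    -- up to `t < T` the total variance stays away from zero
    obtain ⟨s₀, hs₀, hmin⟩ := isCompact_Icc.exists_isMinOn (Set.nonempty_Icc.2 ht.1)
      (hθc.mono hsub)
    have hm : 0 < σ s₀ ^ 2 * (T - s₀) :=
      mul_pos (pow_pos (hσpos s₀ (hsub hs₀)) 2) (sub_pos.2 (hsub' s₀ hs₀).2)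
    exact GammaHedging.gammaHedgingReplicates_of_isHeatTower ht.1 ht.2.le hp hp3 hq hq2 hpq
      (hS.mono_right ht.2.le) (fun s hs => hSpos s (hsub hs)) (hσ.mono_right ht.2.le)
      hf₀.continuousOn hf₁c (fun s hs => hP s (hsub hs)) hm.le
      (fun s hs => ⟨hmin hs, hθM s (hsub hs)⟩)
      (hG₀.mono fun θ hθ => hm.le.trans hθ.1)
      ((hf₁_price.gaussianIntegrable hf₁c).isHeatTower.mono fun θ hθ => hm.trans_le hθ.1)
      fun s hs => (hΓ s (hsub' s hs)).ne'
  · intro hf₁s hf₁''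
    have key := GammaHedging.gammaHedgingReplicates_of_isHeatTower hT.le le_rfl hp hp3 hq hq2 hpq
      hS hSpos hσ hf₀.continuousOn hf₁c hP (le_refl 0)
      (fun s hs => ⟨mul_nonneg (sq_nonneg _) (sub_nonneg.2 hs.2), hθM s hs⟩)
      (hG₀.mono Set.Icc_subset_Ici_self)
      ((GammaHedging.isHeatTower_of_contDiffOn hf₁s hf₁_price).mono Set.Icc_subset_Ici_self)
      fun s hs => by
        rcases hs.2.eq_or_lt with rfl | hsT
        · -- at maturity gamma is the second derivative of the payoff
          have := hf₁'' (S s) (hSpos s hs)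
          rw [sub_self]
          simpa only [GammaHedging.bsGamma, GammaHedging.bsDelta,
            GammaHedging.bsPrice_zero_time] using this.ne'
        · exact (hΓ s ⟨hs.1, hsT⟩).ne'
    rwa [sub_self, GammaHedging.bsPrice_zero_time] at key
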